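/- Let $\Omega$ be either $\mathbb{R}^3$, the torus $\mathbb{T}^3=\mathbb{R}^3/\mathbb{Z}^3$, or a bounded domain of $\mathbb{R}^3$ with smooth boundary. Let $s>9/2$, $T^*\in(0,\infty]$, and let $u$ be a solution on $[0,T^*)\times\Omega$ of the incompressible Euler equation $$\partial_t u+(u\cdot\nabla)u+\nabla P=0,\qquad \mathrm{div}\,u=0,$$ with, in the presence of a boundary, the impermeability condition $u\cdot\mathbf{n}=0$ on $\partial\Omega$, such that $u\in C^0([0,T];H^s(\Omega))\cap C^1([0,T];H^{s-1}(\Omega))$ for every $T<T^*$. Let $\omega=\mathrm{curl}\,u$ and $\omega^0=\omega(0,\cdot)$. For $T\in[0,T^*)$ define $$\beta(T)=\sup |b_T|\in[0,\infty],$$ where the supremum is over all solutions $(\gamma_t,\xi_t,b_t)$, $t\in[0,T]$, with $\gamma_t\in\Omega$ and $\xi_t,b_t\in\mathbb{R}^3$, of the bicharacteristic-amplitude equations $$\dot\gamma_t=u(t,\gamma_t),\qquad \dot\xi_t=-(\partial_xu)^T\xi_t,\qquad \dot b_t=-(\partial_xu)\,b_t+2\,\frac{\xi_t^T(\partial_xu)\,b_t}{|\xi_t|^2}\,\xi_t,\qquad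 (\partial_xu)_{ij}=\partial_ju_i(t,\gamma_t),$$ with initial values satisfying $\gamma_0\in\Omega$, $|\xi_0|=|b_0|=1$ and $b_0\cdot\xi_0=0$. Then, for every $T\in[0,T^*)$, $$\frac{1}{\sqrt{\|\omega^0\|_{L^\infty(\Omega)}}}\,\sup_{x\in\Omega}\sqrt{|\omega(T,x)|}\;\le\;\beta(T).$$ (The quotient is taken in $[0,\infty]$ with $0/0=0$ and $a/0=\infty$ for $a>0$, which matters only if $\omega^0\equiv0$.) -/

import Mathlib

open MeasureTheory Set Filter Topology FourierTransform
open scoped ENNReal ContDiff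

noncomputable section

namespace EulerFlow

/-- Euclidean three-space. -/
abbrev E3 : Type := EuclideanSpace ℝ (Fin 3)

/-- Its complexification, used as the target of Fourier transforms. -/
abbrev C3 : Type := EuclideanSpace ℂ (Fin 3)

/-! ### Regular bounded domains -/

/-- `ρ` is a smooth defining function of `Ω` near the boundary point `p`: near `p` the set `Ω` is
`{ρ < 0}`, and `∇ρ(p) ≠ 0`, so that near `p` the boundary is the smooth surface `{ρ = 0}`. -/
structure IsDefiningFunctionAt (Ω : Set E3) (p : E3) (ρ : E3 → ℝ) : Prop where
  smooth : ContDiff ℝ ∞ ρ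
  zero : ρ p = 0
  regular : gradient ρ p ≠ 0
  mem_iff : ∀ᶠ x in 𝓝 p, (x ∈ Ω ↔ ρ x < 0)

/-- `n` is the outward unit normal of `∂Ω` at `p`. -/
def IsOutwardUnitNormal (Ω : Set E3) (p n : E3) : Prop :=
  ∃ ρ : E3 → ℝ, IsDefiningFunctionAt Ω p ρ ∧ n = ‖gradient ρ p‖⁻¹ • gradient ρ p

/-- Bounded open sets with smooth boundary. Connectedness is not required. -/
structure IsSmoothBoundedDomain (Ω : Set E3) : Prop where
  isOpen : IsOpen Ω
  isBounded : Bornology.IsBounded Ω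
  boundary : ∀ p ∈ frontier Ω, ∃ ρ : E3 → ℝ, IsDefiningFunctionAt Ω p ρ

/-- The three kinds of fluid domain: the whole space `ℝ³`, the flat torus `𝕋³ = ℝ³/ℤ³`, and the
bounded domains with smooth boundary. -/
inductive FluidDomain where
  | space : FluidDomain
  | torus : FluidDomain
  | bounded (Ω : Set E3) (hΩ : IsSmoothBoundedDomain Ω) : FluidDomain

/-- The points of the domain. Points of the torus are represented by all their lifts to `ℝ³`. -/
def FluidDomain.carrier : FluidDomain → Set E3
  | .space => univ
  | .torus => univ
  | .bounded Ω _ => Ω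

/-- Functions on the torus are represented by the `ℤ³`-periodic functions on `ℝ³`; on the other
domains there is no condition. -/
def FluidDomain.IsFunction {α : Type} : FluidDomain → (E3 → α) → Prop
  | .space, _ => True
  | .torus, f => ∀ (x : E3) (i : Fin 3), f (x + EuclideanSpace.single i 1) = f x
  | .bounded _ _, _ => True

/-- Impermeability of the boundary, `v · n = 0` on `∂Ω`; no condition if there is no boundary. -/
def FluidDomain.Impermeable : FluidDomain → (E3 → E3) → Prop
  | .space, _ => True
  | .torus, _ => True
  | .bounded Ω _, v => ∀ p ∈ frontier Ω, ∀ n : E3, IsOutwardUnitNormal Ω p n → inner ℝ (v p) n = 0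

/-! ### Sobolev norms of real order

All norms are extended: the value is `∞` exactly for functions that are not in the space. -/

/-- A real vector field seen as a complex one. -/
def complexify (f : E3 → E3) (x : E3) : C3 := WithLp.toLp 2 fun i => ((f x i : ℝ) : ℂ)

/-- The norm of `H^s(ℝ³; ℝ³)`, `s ≥ 0`: the `L²` norm of `(1 + |ξ|²)^{s/2} f̂(ξ)` for `f ∈ L²`. -/
def spaceSobolevNorm (s : ℝ) (f : E3 → E3) : ℝ≥0∞ :=
  ⨅ h : MemLp (complexify f) 2 (volume : Measure E3),
    eLpNorm (fun ξ : E3 =>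
      ((1 + ‖ξ‖ ^ 2) ^ (s / 2) : ℝ) • (𝓕 (h.toLp (complexify f)) : Lp C3 2 (volume : Measure E3)) ξ)
      2 (volume : Measure E3)

/-- The representative in `[0,1)³` of a point of the torus `ℝ³/ℤ³`. -/
def torusRep (y : UnitAddTorus (Fin 3)) : E3 :=
  WithLp.toLp 2 fun i => ((AddCircle.equivIco (1 : ℝ) 0 (y i) : ℝ))

/-- The norm of `H^s(𝕋³; ℝ³)`, `s ≥ 0`: `(∑ₖ (1 + |k|²)^s |f̂(k)|²)^{1/2}` for `f ∈ L²`, where `f` is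
a periodic function. -/
def torusSobolevNorm (s : ℝ) (f : E3 → E3) : ℝ≥0∞ :=
  ⨅ _ : MemLp f 2 ((volume : Measure E3).restrict {x | ∀ i, x i ∈ Ico (0 : ℝ) 1}),
    (∑' k : Fin 3 → ℤ, ENNReal.ofReal ((1 + ∑ i, (k i : ℝ) ^ 2) ^ s) *
      ‖UnitAddTorus.mFourierCoeff (fun y => complexify f (torusRep y)) k‖ₑ ^ 2) ^ (1 / 2 : ℝ)

/-- The norm of `H^s(Ω; ℝ³)`, the space of restrictions to `Ω` of functions in `H^s(ℝ³; ℝ³)`, with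
the quotient norm. -/
def domainSobolevNorm (Ω : Set E3) (s : ℝ) (f : E3 → E3) : ℝ≥0∞ :=
  ⨅ (g : E3 → E3) (_ : g =ᵐ[(volume : Measure E3).restrict Ω] f), spaceSobolevNorm s g

/-- The `H^s` norm on a fluid domain. -/
def FluidDomain.sobolevNorm : FluidDomain → ℝ → (E3 → E3) → ℝ≥0∞
  | .space, s, f => spaceSobolevNorm s f
  | .torus, s, f => torusSobolevNorm s f
  | .bounded Ω _, s, f => domainSobolevNorm Ω s f

/-! ### Regularity in time -/

/-- The time interval `[0, T*)`, where `T* = ∞` is allowed. -/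
def timeInterval (Tstar : EReal) : Set ℝ := {t | 0 ≤ t ∧ (t : EReal) < Tstar}

/-- `u ∈ C⁰([0,T*); H^s)`. -/
def IsC0InTime (D : FluidDomain) (s : ℝ) (Tstar : EReal) (u : ℝ → E3 → E3) : Prop :=
  ∀ t ∈ timeInterval Tstar, D.sobolevNorm s (u t) < ⊤ ∧
    Tendsto (fun τ => D.sobolevNorm s (u τ - u t)) (𝓝[timeInterval Tstar] t) (𝓝 0)

/-- `u ∈ C¹([0,T*); H^s)`: the difference quotients converge in `H^s` to some
`w ∈ C⁰([0,T*); H^s)`. -/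
def IsC1InTime (D : FluidDomain) (s : ℝ) (Tstar : EReal) (u : ℝ → E3 → E3) : Prop :=
  IsC0InTime D s Tstar u ∧
    ∃ w : ℝ → E3 → E3, IsC0InTime D s Tstar w ∧
      ∀ t ∈ timeInterval Tstar,
        Tendsto (fun τ => D.sobolevNorm s ((τ - t)⁻¹ • (u τ - u t) - w t))
          (𝓝[timeInterval Tstar \ {t}] t) (𝓝 0)

/-! ### The Euler equation -/

/-- The divergence of a vector field. -/
def divergence (v : E3 → E3) (x : E3) : ℝ :=
  ∑ i, fderiv ℝ v x (EuclideanSpace.single i 1) i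

/-- The curl of a vector field. -/
def curl (v : E3 → E3) (x : E3) : E3 :=
  let d (j i : Fin 3) : ℝ := fderiv ℝ v x (EuclideanSpace.single j 1) i
  !₂[d 1 2 - d 2 1, d 2 0 - d 0 2, d 0 1 - d 1 0]

/-- `u` is a solution on `[0,T*)`, of class `C⁰([0,T]; H^s) ∩ C¹([0,T]; H^{s-1})` for every `T < T*`,
of the incompressible Euler equation on the fluid domain `D`, with impermeable boundary.
Elements of `H^s` are represented by their continuous representatives on the closed domain. -/
structure IsEulerSolution (D : FluidDomain) (s : ℝ) (Tstar : EReal) (u : ℝ → E3 → E3) : Prop where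
  isFunction : ∀ t ∈ timeInterval Tstar, D.IsFunction (u t)
  continuousOn : ∀ t ∈ timeInterval Tstar, ContinuousOn (u t) (closure D.carrier)
  isC0 : IsC0InTime D s Tstar u
  isC1 : IsC1InTime D (s - 1) Tstar u
  /-- `∂ₜu + (u·∇)u + ∇P = 0` for some pressure `P`. -/
  momentum : ∃ P : ℝ → E3 → ℝ, ∀ t ∈ timeInterval Tstar, 0 < t →
    D.IsFunction (P t) ∧ ∀ x ∈ D.carrier, DifferentiableAt ℝ (P t) x ∧
      HasDerivAt (fun τ => u τ x) (-(fderiv ℝ (u t) x (u t x)) - gradient (P t) x) t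
  incompressible : ∀ t ∈ timeInterval Tstar, 0 < t → ∀ x ∈ D.carrier, divergence (u t) x = 0
  impermeable : ∀ t ∈ timeInterval Tstar, 0 < t → D.Impermeable (u t)

/-! ### The bicharacteristic-amplitude equations -/

/-- `(γ, ξ, b)` solves on `[0,T]` the system
`γ' = u(t,γ)`, `ξ' = -(∂ₓu)ᵀ ξ`, `b' = -(∂ₓu) b + 2 (ξᵀ (∂ₓu) b / |ξ|²) ξ`,
where `∂ₓu` is the Jacobian matrix of `u(t,·)` at `γ`. -/
structure IsBicharacteristic (D : FluidDomain) (u : ℝ → E3 → E3) (T : ℝ) (γ ξ b : ℝ → E3) :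
    Prop where
  mem : ∀ t ∈ Icc 0 T, γ t ∈ D.carrier
  position : ∀ t ∈ Icc 0 T, HasDerivWithinAt γ (u t (γ t)) (Icc 0 T) t
  frequency : ∀ t ∈ Icc 0 T, HasDerivWithinAt ξ
    (-(ContinuousLinearMap.adjoint (fderiv ℝ (u t) (γ t)) (ξ t))) (Icc 0 T) t
  amplitude : ∀ t ∈ Icc 0 T, HasDerivWithinAt b
    (-(fderiv ℝ (u t) (γ t) (b t)) +
      (2 * (inner ℝ (ξ t) (fderiv ℝ (u t) (γ t) (b t)) / ‖ξ t‖ ^ 2)) • ξ t) (Icc 0 T) t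

/-- `β(T)`: the supremum of `|b(T)|` over the solutions with `γ(0) ∈ Ω`, `|ξ(0)| = |b(0)| = 1` and
`b(0) · ξ(0) = 0`. -/
def beta (D : FluidDomain) (u : ℝ → E3 → E3) (T : ℝ) : ℝ≥0∞ :=
  ⨆ (γ : ℝ → E3) (ξ : ℝ → E3) (b : ℝ → E3) (_ : IsBicharacteristic D u T γ ξ b)
    (_ : ‖b 0‖ = 1) (_ : ‖ξ 0‖ = 1) (_ : inner ℝ (b 0) (ξ 0) = 0), ‖b T‖ₑ

end EulerFlow

end

/-! Fix `x` with `ω(T,x) ≠ 0` and follow the fluid trajectory through `x` back to time `0`. With `A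
= ∂ₓu` along it, the curl of the Euler equation reads `ω' = Aω`, whereas a frequency satisfies `ξ' =
-Aᵀξ`, so `ω · ξ` is conserved. Take the frequency parallel to `ω` at time `T`, normalised by
`|ξ(0)| = 1`: conservation gives `|ω(T)| |ξ(T)| = ω(0) · ξ(0) ≤ |ω(0)|`, so a large growth of
vorticity forces `ξ(T)` to be small.

A small frequency forces a large amplitude. Let `b`, `c` be two amplitudes over this frequency with
`(b, c, ξ)` orthonormal at time `0`. The amplitude equation preserves orthogonality to `ξ`, and then
`det (b, c, ξ)` is constant because `tr A = 0`. Hence `1 ≤ |b(T)| |c(T)| |ξ(T)|`, so one of the two,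
say `b`, has `1 ≤ |b(T)|² |ξ(T)|`, and `|ω(T)| ≤ |ω(0)| |b(T)|²`. This is `exists_amplitude`; the
theorem is its square root.

The remaining work justifies the calculus. As `s - 1 > 7/2`, the Sobolev embedding turns the time
regularity in `H^{s-1}` into that of `IsRegularVelocity`, enough to differentiate `∂ₓu` along a
trajectory (`hasDerivWithinAt_fderiv`) and obtain the vorticity equation (`hasDerivWithinAt_axial`).
In a bounded domain, tangency of `u` to the boundary keeps backward trajectories inside
(`mem_of_backward`). -/

namespace EulerFlow

/-! ### Ordinary differential equations on a compact time interval -/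

section ODE

variable {E : Type*} [NormedAddCommGroup E] [NormedSpace ℝ E]

/-- A globally Lipschitz vector field has a solution on the whole time interval. -/
theorem exists_forward_solution [CompleteSpace E] {f : ℝ → E → E} {K : ℝ} {T : ℝ} (hT : 0 ≤ T)
    (hK : 0 ≤ K)
    (hf : ∀ t ∈ Icc 0 T, ∀ x y, ‖f t x - f t y‖ ≤ K * ‖x - y‖)
    (hc : ∀ x, ContinuousOn (fun t => f t x) (Icc 0 T)) (x₀ : E) :
    ∃ γ : ℝ → E, γ 0 = x₀ ∧ ∀ t ∈ Icc 0 T, HasDerivWithinAt γ (f t (γ t)) (Icc 0 T) t := by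
  obtain ⟨C, hC⟩ := (isCompact_Icc (a := (0 : ℝ)) (b := T)).exists_bound_of_continuousOn (hc 0)
  have hC0 : 0 ≤ C := (norm_nonneg _).trans (hC 0 ⟨le_rfl, hT⟩)
  have hgrow : ∀ t ∈ Icc 0 T, ∀ x, ‖f t x‖ ≤ K * ‖x‖ + C := by
    intro t ht x
    have h1 := hf t ht x 0
    have h2 := hC t ht
    have h3 := norm_le_norm_sub_add (f t x) (f t 0)
    rw [sub_zero] at h1
    linarith
  -- Grönwall's inequality bounds every solution by `R`, so `f` may be cut off beyond this radius;
  -- the `+ 1` makes `R` positive.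
  set R : ℝ := gronwallBound ‖x₀‖ K C T + 1 with hR
  have hg0 : 0 ≤ gronwallBound ‖x₀‖ K C T := by
    have := gronwallBound_mono (norm_nonneg x₀) hC0 hK hT
    rw [gronwallBound_x0] at this
    exact (norm_nonneg _).trans this
  have hRpos : 0 < R := by linarith
  let φ : E → ℝ := fun x => max 0 (min 1 (2 - ‖x‖ / R))
  have hφ0 : ∀ x, 0 ≤ φ x := fun x => le_max_left _ _
  have hφ1 : ∀ x, φ x ≤ 1 := fun x => max_le zero_le_one (min_le_left _ _)
  have hφin : ∀ x, ‖x‖ ≤ R → φ x = 1 := by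
    intro x hx
    have : ‖x‖ / R ≤ 1 := by rwa [div_le_one hRpos]
    simp only [φ]
    rw [min_eq_left (by linarith), max_eq_right zero_le_one]
  have hφout : ∀ x, 2 * R ≤ ‖x‖ → φ x = 0 := by
    intro x hx
    have : 2 ≤ ‖x‖ / R := by rwa [le_div_iff₀ hRpos]
    exact max_eq_left ((min_le_right _ _).trans (by linarith))
  have hφlip : ∀ x y, |φ x - φ y| ≤ ‖x - y‖ / R := by
    intro x y
    calc |φ x - φ y| ≤ |min 1 (2 - ‖x‖ / R) - min 1 (2 - ‖y‖ / R)| := by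
          have := abs_max_sub_max_le_max (0 : ℝ) (min 1 (2 - ‖x‖ / R)) 0 (min 1 (2 - ‖y‖ / R))
          simpa using this
      _ ≤ |(2 - ‖x‖ / R) - (2 - ‖y‖ / R)| := by
          have := abs_min_sub_min_le_max (1 : ℝ) (2 - ‖x‖ / R) 1 (2 - ‖y‖ / R)
          simpa using this
      _ = |‖x‖ - ‖y‖| / R := by
          rw [← abs_of_pos hRpos, ← abs_div, abs_of_pos hRpos, ← abs_neg]
          congr 1
          ring
      _ ≤ ‖x - y‖ / R := by
          gcongr
          exact abs_norm_sub_norm_le x y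
  let g : ℝ → E → E := fun t x => φ x • f t x
  let L : ℝ := K * (2 * R) + C
  have hL0 : 0 ≤ L := by positivity
  have hgL : ∀ t ∈ Icc 0 T, ∀ x, ‖g t x‖ ≤ L := by
    intro t ht x
    simp only [g, norm_smul, Real.norm_eq_abs, abs_of_nonneg (hφ0 x)]
    rcases le_total (2 * R) ‖x‖ with h | h
    · rw [hφout x h, zero_mul]
      exact hL0
    · calc φ x * ‖f t x‖ ≤ 1 * ‖f t x‖ := by gcongr; exact hφ1 x
        _ ≤ L := by
          rw [one_mul]
          exact (hgrow t ht x).trans (by simp only [L]; gcongr)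
  -- Picard–Lindelöf requires speed times duration at most the radius. The truncated field has speed
  -- at most `L` everywhere, so this radius reaches time `T` in one step.
  let a : ℝ := L * T
  have ha0 : 0 ≤ a := by positivity
  let B : ℝ := K * (‖x₀‖ + a) + C
  have hB0 : 0 ≤ B := by positivity
  have hPL : IsPicardLindelof g (⟨0, le_rfl, hT⟩ : Icc 0 T) x₀ ⟨a, ha0⟩ 0 ⟨L, hL0⟩
      ⟨B / R + K, by positivity⟩ := by
    refine ⟨fun t ht => ?_, fun x _ => (hc x).const_smul (φ x), fun t ht x _ => hgL t ht x, ?_⟩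
    · refine LipschitzOnWith.of_dist_le_mul fun x hx y _ => ?_
      have hxn : ‖x‖ ≤ ‖x₀‖ + a := by
        have : ‖x - x₀‖ ≤ a := mem_closedBall_iff_norm.1 hx
        linarith [norm_le_norm_sub_add x x₀]
      have hfx : ‖f t x‖ ≤ B := (hgrow t ht x).trans (by simp only [B]; gcongr)
      rw [dist_eq_norm, dist_eq_norm]
      have : g t x - g t y = (φ x - φ y) • f t x + φ y • (f t x - f t y) := by
        simp only [g, sub_smul, smul_sub]
        abel
      rw [this]
      calc _ ≤ ‖(φ x - φ y) • f t x‖ + ‖φ y • (f t x - f t y)‖ := norm_add_le _ _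
        _ ≤ ‖x - y‖ / R * B + 1 * (K * ‖x - y‖) := by
          rw [norm_smul, norm_smul, Real.norm_eq_abs, Real.norm_eq_abs, abs_of_nonneg (hφ0 y)]
          gcongr
          · exact hφlip x y
          · exact hφ1 y
          · exact hf t ht x y
        _ = (B / R + K) * ‖x - y‖ := by ring
    · simp only [sub_zero, sub_self, max_eq_left hT]
      exact (sub_zero a).ge
  obtain ⟨γ, hγ0, hγ⟩ := hPL.exists_eq_forall_mem_Icc_hasDerivWithinAt₀
  refine ⟨γ, hγ0, fun t ht => ?_⟩
  -- The truncated field obeys the same linear growth bound, since `φ ≤ 1`; its solution therefore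
  -- stays where `φ = 1`.
  have hbound : ‖γ t‖ ≤ R := by
    have := norm_le_gronwallBound_of_norm_deriv_right_le (f := γ) (f' := fun t => g t (γ t))
      (δ := ‖x₀‖) (K := K) (ε := C) (a := 0) (b := T)
      (fun t ht => (hγ t ht).continuousWithinAt)
      (fun t ht => (hγ t ⟨ht.1, ht.2.le⟩).mono_of_mem_nhdsWithin
        (mem_of_superset (Icc_mem_nhdsGE ht.2) (Icc_subset_Icc_left ht.1)))
      (by rw [← hγ0]) (fun t ht => ?_) t ht
    · rw [sub_zero] at this
      have h2 := gronwallBound_mono (norm_nonneg x₀) hC0 hK ht.2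
      linarith
    · simp only [g, norm_smul, Real.norm_eq_abs, abs_of_nonneg (hφ0 _)]
      calc φ (γ t) * ‖f t (γ t)‖ ≤ 1 * ‖f t (γ t)‖ := by gcongr; exact hφ1 _
        _ ≤ _ := by
          rw [one_mul]
          exact hgrow t ⟨ht.1, ht.2.le⟩ _
  have := hγ t ht
  simpa only [g, hφin _ hbound, one_smul] using this

/-- Time reversal on the interval `[0, T]`. -/
theorem hasDerivWithinAt_comp_reverse {γ : ℝ → E} {T t : ℝ} {v : E}
    (h : HasDerivWithinAt γ v (Icc 0 T) (T - t)) :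
    HasDerivWithinAt (fun τ => γ (T - τ)) (-v) (Icc 0 T) t := by
  have h1 : HasDerivWithinAt (fun τ : ℝ => T - τ) (-1) (Icc 0 T) t := by
    simpa using ((hasDerivAt_id t).const_sub T).hasDerivWithinAt
  have := h.scomp t h1 (fun τ hτ => ⟨by linarith [hτ.2], by linarith [hτ.1]⟩)
  simpa [Function.comp_def] using this

/-- Existence for the final value problem. -/
theorem exists_backward_solution [CompleteSpace E] {f : ℝ → E → E} {K : ℝ} {T : ℝ} (hT : 0 ≤ T)
    (hK : 0 ≤ K)
    (hf : ∀ t ∈ Icc 0 T, ∀ x y, ‖f t x - f t y‖ ≤ K * ‖x - y‖)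
    (hc : ∀ x, ContinuousOn (fun t => f t x) (Icc 0 T)) (x₀ : E) :
    ∃ γ : ℝ → E, γ T = x₀ ∧ ∀ t ∈ Icc 0 T, HasDerivWithinAt γ (f t (γ t)) (Icc 0 T) t := by
  have hmem : ∀ t ∈ Icc 0 T, T - t ∈ Icc 0 T := fun t ht =>
    ⟨by linarith [ht.2], by linarith [ht.1]⟩
  obtain ⟨γ, h0, hγ⟩ := exists_forward_solution (f := fun t x => -f (T - t) x) hT hK
    (fun t ht x y => by
      rw [neg_sub_neg, norm_sub_rev]
      exact hf _ (hmem t ht) x y)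
    (fun x => ((hc x).comp (by fun_prop) (fun t ht => hmem t ht)).neg) x₀
  refine ⟨fun t => γ (T - t), by simpa using h0, fun t ht => ?_⟩
  have := hasDerivWithinAt_comp_reverse (hγ (T - t) (hmem t ht))
  simpa using this

theorem exists_bound_clm {F : Type*} [NormedAddCommGroup F] [NormedSpace ℝ F] {A : ℝ → E →L[ℝ] F}
    {T : ℝ} (hA : ContinuousOn A (Icc 0 T)) :
    ∃ K, 0 ≤ K ∧ ∀ t ∈ Icc 0 T, ∀ x y, ‖A t x - A t y‖ ≤ K * ‖x - y‖ := by
  obtain ⟨K, hK⟩ := isCompact_Icc.exists_bound_of_continuousOn hA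
  refine ⟨max K 0, le_max_right _ _, fun t ht x y => ?_⟩
  rw [← map_sub]
  exact (A t).le_of_opNorm_le ((hK t ht).trans (le_max_left _ _)) _

theorem exists_forward_linear_solution [CompleteSpace E] {A : ℝ → E →L[ℝ] E} {T : ℝ} (hT : 0 ≤ T)
    (hA : ContinuousOn A (Icc 0 T)) (x₀ : E) :
    ∃ γ : ℝ → E, γ 0 = x₀ ∧ ∀ t ∈ Icc 0 T, HasDerivWithinAt γ (A t (γ t)) (Icc 0 T) t := by
  obtain ⟨K, hK0, hK⟩ := exists_bound_clm hA
  exact exists_forward_solution hT hK0 hK (fun x => hA.clm_apply continuousOn_const) x₀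

theorem exists_backward_linear_solution [CompleteSpace E] {A : ℝ → E →L[ℝ] E} {T : ℝ} (hT : 0 ≤ T)
    (hA : ContinuousOn A (Icc 0 T)) (x₀ : E) :
    ∃ γ : ℝ → E, γ T = x₀ ∧ ∀ t ∈ Icc 0 T, HasDerivWithinAt γ (A t (γ t)) (Icc 0 T) t := by
  obtain ⟨K, hK0, hK⟩ := exists_bound_clm hA
  exact exists_backward_solution hT hK0 hK (fun x => hA.clm_apply continuousOn_const) x₀

/-- A function continuous on `[0, T]` with zero derivative inside is constant. -/
theorem eq_initial_of_hasDerivWithinAt_zero {g : ℝ → ℝ} {T : ℝ} (hg : ContinuousOn g (Icc 0 T))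
    (h : ∀ t ∈ Ioo 0 T, HasDerivWithinAt g 0 (Icc 0 T) t) : ∀ t ∈ Icc 0 T, g t = g 0 := by
  intro t ht
  rcases ht.1.eq_or_lt with rfl | h0
  · rfl
  -- The mean value theorem needs no derivative at the endpoints. This matters because the Euler
  -- equations are imposed only for positive times.
  obtain ⟨c, hc, hc'⟩ := exists_hasDerivAt_eq_slope g (fun _ => 0) h0
    (hg.mono (Icc_subset_Icc_right ht.2))
    (fun x hx => (h x ⟨hx.1, hx.2.trans_le ht.2⟩).hasDerivAt
      (Icc_mem_nhds hx.1 (hx.2.trans_le ht.2)))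
  rw [eq_div_iff (by linarith), zero_mul] at hc'
  linarith

end ODE

end EulerFlow

namespace EulerFlow

/-! ### Matrices, axial vectors and determinants in dimension three -/

section LinearAlgebra

/-- The entry `(i, j)` of the matrix of a linear map. -/
noncomputable def entry (A : E3 →L[ℝ] E3) (i j : Fin 3) : ℝ := A (EuclideanSpace.single j 1) i

/-- The axial vector of the antisymmetric part; `curl v x = axial (fderiv ℝ v x)`. -/
noncomputable def axial (A : E3 →L[ℝ] E3) : E3 :=
  !₂[entry A 2 1 - entry A 1 2, entry A 0 2 - entry A 2 0, entry A 1 0 - entry A 0 1]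

theorem curl_eq_axial (v : E3 → E3) (x : E3) : curl v x = axial (fderiv ℝ v x) := rfl

/-- The trace of a linear map. -/
noncomputable def tr (A : E3 →L[ℝ] E3) : ℝ := entry A 0 0 + entry A 1 1 + entry A 2 2

theorem divergence_eq_tr (v : E3 → E3) (x : E3) : divergence v x = tr (fderiv ℝ v x) := by
  simp [divergence, Fin.sum_univ_three, tr, entry]

theorem inner_coord (v w : E3) : inner ℝ v w = v 0 * w 0 + v 1 * w 1 + v 2 * w 2 := by
  simp [PiLp.inner_apply, Fin.sum_univ_three, mul_comm]

theorem norm_sq_coord (v : E3) : ‖v‖ ^ 2 = v 0 ^ 2 + v 1 ^ 2 + v 2 ^ 2 := by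
  simp [EuclideanSpace.real_norm_sq_eq, Fin.sum_univ_three]

theorem apply_coord (A : E3 →L[ℝ] E3) (v : E3) (i : Fin 3) :
    A v i = entry A i 0 * v 0 + entry A i 1 * v 1 + entry A i 2 * v 2 := by
  have hv : v = v 0 • EuclideanSpace.single 0 (1 : ℝ) + v 1 • EuclideanSpace.single 1 (1 : ℝ)
      + v 2 • EuclideanSpace.single 2 (1 : ℝ) := by
    ext i
    fin_cases i <;> simp
  conv_lhs => rw [hv]
  simp only [map_add, map_smul, PiLp.add_apply, PiLp.smul_apply, smul_eq_mul, entry]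
  ring

theorem adjoint_coord (A : E3 →L[ℝ] E3) (v : E3) (i : Fin 3) :
    ContinuousLinearMap.adjoint A v i = entry A 0 i * v 0 + entry A 1 i * v 1 + entry A 2 i * v 2 := by
  have h := ContinuousLinearMap.adjoint_inner_right A (EuclideanSpace.single i (1 : ℝ)) v
  rw [EuclideanSpace.inner_single_left] at h
  rw [inner_coord] at h
  simpa [entry] using h

theorem hasDerivWithinAt_coord {f : ℝ → E3} {v : E3} {s : Set ℝ} {t : ℝ}
    (h : HasDerivWithinAt f v s t) (i : Fin 3) : HasDerivWithinAt (fun τ => f τ i) (v i) s t :=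
  (EuclideanSpace.proj i : E3 →L[ℝ] ℝ).hasFDerivAt.comp_hasDerivWithinAt t h

/-- The determinant of three vectors. -/
noncomputable def det3 (b c ξ : E3) : ℝ :=
  (b 1 * c 2 - b 2 * c 1) * ξ 0 + (b 2 * c 0 - b 0 * c 2) * ξ 1 + (b 0 * c 1 - b 1 * c 0) * ξ 2

/-- The determinant is `(b × c) · ξ`: Cauchy–Schwarz, then `|b × c| ≤ |b| |c|`, each a Lagrange
identity up to a sum of squares. -/
theorem det3_sq_le (b c ξ : E3) : det3 b c ξ ^ 2 ≤ ‖b‖ ^ 2 * ‖c‖ ^ 2 * ‖ξ‖ ^ 2 := by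
  set p := b 1 * c 2 - b 2 * c 1 with hp
  set q := b 2 * c 0 - b 0 * c 2 with hq
  set r := b 0 * c 1 - b 1 * c 0 with hr
  have h1 : det3 b c ξ ^ 2 ≤ (p ^ 2 + q ^ 2 + r ^ 2) * ‖ξ‖ ^ 2 := by
    rw [norm_sq_coord]
    have : det3 b c ξ = p * ξ 0 + q * ξ 1 + r * ξ 2 := rfl
    rw [this]
    nlinarith [sq_nonneg (p * ξ 1 - q * ξ 0), sq_nonneg (p * ξ 2 - r * ξ 0),
      sq_nonneg (q * ξ 2 - r * ξ 1)]
  have h2 : p ^ 2 + q ^ 2 + r ^ 2 ≤ ‖b‖ ^ 2 * ‖c‖ ^ 2 := by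
    rw [norm_sq_coord, norm_sq_coord, hp, hq, hr]
    nlinarith [sq_nonneg (b 0 * c 0 + b 1 * c 1 + b 2 * c 2)]
  exact h1.trans (by gcongr)

/-- A unit vector completes to an orthonormal frame, of determinant `1`. -/
theorem exists_frame (ξ : E3) (hξ : ‖ξ‖ = 1) :
    ∃ b c : E3, ‖b‖ = 1 ∧ ‖c‖ = 1 ∧ inner ℝ b ξ = 0 ∧ inner ℝ c ξ = 0 ∧ det3 b c ξ = 1 := by
  have hξ2 : ξ 0 ^ 2 + ξ 1 ^ 2 + ξ 2 ^ 2 = 1 := by rw [← norm_sq_coord, hξ, one_pow]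
  obtain ⟨b, hb, hbξ⟩ : ∃ b : E3, ‖b‖ = 1 ∧ inner ℝ b ξ = 0 := by
    suffices h : ∃ v : E3, v ≠ 0 ∧ inner ℝ v ξ = 0 by
      obtain ⟨v, hv, hvξ⟩ := h
      refine ⟨‖v‖⁻¹ • v, norm_smul_inv_norm hv, ?_⟩
      rw [inner_smul_left, hvξ, mul_zero]
    by_cases h : ξ 0 = 0
    · refine ⟨EuclideanSpace.single 0 1, by simp, ?_⟩
      simp [inner_coord, h]
    · refine ⟨!₂[-ξ 1, ξ 0, 0], fun h0 => h ?_, ?_⟩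
      · simpa using congrArg (fun v : E3 => v 1) h0
      · simp [inner_coord]
        ring
  have hb2 : b 0 ^ 2 + b 1 ^ 2 + b 2 ^ 2 = 1 := by rw [← norm_sq_coord, hb, one_pow]
  rw [inner_coord] at hbξ
  -- This is `ξ × b`, so the determinant equals `|c|²`, which is `|ξ|² |b|² - (b · ξ)² = 1`.
  let c : E3 := !₂[ξ 1 * b 2 - ξ 2 * b 1, ξ 2 * b 0 - ξ 0 * b 2, ξ 0 * b 1 - ξ 1 * b 0]
  have hc0 : c 0 = ξ 1 * b 2 - ξ 2 * b 1 := rfl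
  have hc1 : c 1 = ξ 2 * b 0 - ξ 0 * b 2 := rfl
  have hc2 : c 2 = ξ 0 * b 1 - ξ 1 * b 0 := rfl
  have hkey : c 0 ^ 2 + c 1 ^ 2 + c 2 ^ 2 = 1 := by
    rw [hc0, hc1, hc2]
    linear_combination hb2 * (ξ 0 ^ 2 + ξ 1 ^ 2 + ξ 2 ^ 2) + hξ2 -
      hbξ * (b 0 * ξ 0 + b 1 * ξ 1 + b 2 * ξ 2)
  refine ⟨b, c, hb, ?_, by rw [inner_coord]; exact hbξ, ?_, ?_⟩
  · rw [← sq_eq_sq₀ (norm_nonneg _) zero_le_one, norm_sq_coord, hkey, one_pow]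
  · rw [inner_coord, hc0, hc1, hc2]
    ring
  · rw [← hkey, det3, hc0, hc1, hc2]
    ring

theorem continuous_axial : Continuous axial := by
  have h : ∀ i j, Continuous fun A : E3 →L[ℝ] E3 => entry A i j := fun i j => by
    unfold entry
    fun_prop
  unfold axial
  refine (PiLp.continuous_toLp 2 _).comp (continuous_pi fun i => ?_)
  fin_cases i
  · exact (h 2 1).sub (h 1 2)
  · exact (h 0 2).sub (h 2 0)
  · exact (h 1 0).sub (h 0 1)

end LinearAlgebra

/-! ### Conservation laws of the bicharacteristic-amplitude system -/

section Amplitude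

variable {A : ℝ → E3 →L[ℝ] E3} {T : ℝ} {ξ b c : ℝ → E3}

/-- The coefficient of the amplitude equation. -/
noncomputable def amplitudeMap (A : E3 →L[ℝ] E3) (ξ : E3) : E3 →L[ℝ] E3 :=
  -A + (2 / ‖ξ‖ ^ 2) • ((innerSL ℝ ξ).comp A).smulRight ξ

theorem amplitudeMap_apply (A : E3 →L[ℝ] E3) (ξ b : E3) :
    amplitudeMap A ξ b = -(A b) + (2 * (inner ℝ ξ (A b) / ‖ξ‖ ^ 2)) • ξ := by
  simp only [amplitudeMap, add_apply, neg_apply,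
    smul_apply, ContinuousLinearMap.smulRight_apply,
    ContinuousLinearMap.comp_apply, innerSL_apply_apply, smul_smul]
  congr 2
  ring

theorem continuousOn_amplitudeMap {s : Set ℝ} (hA : ContinuousOn A s) (hξ : ContinuousOn ξ s)
    (h0 : ∀ t ∈ s, ξ t ≠ 0) : ContinuousOn (fun t => amplitudeMap (A t) (ξ t)) s := by
  unfold amplitudeMap
  refine hA.neg.add (ContinuousOn.smul (f := fun t => 2 / ‖ξ t‖ ^ 2)
    (g := fun t => ((innerSL ℝ (ξ t)).comp (A t)).smulRight (ξ t)) ?_ ?_)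
  · exact continuousOn_const.div (hξ.norm.pow 2) fun t ht => by simpa using h0 t ht
  · have h1 : ContinuousOn (fun t => (innerSL ℝ (ξ t)).comp (A t)) s :=
      ((innerSL ℝ).continuous.comp_continuousOn hξ).clm_comp hA
    exact ((ContinuousLinearMap.smulRightL ℝ E3 E3).continuous.comp_continuousOn h1).clm_apply hξ

/-- The term with factor `2` contributes `2 ξ · Ab` to the derivative of `b · ξ`, which cancels the
two equal terms `-Ab · ξ` and `-b · Aᵀξ`. -/
theorem inner_amplitude_eq_zero
    (hξ0 : ∀ t ∈ Icc 0 T, ξ t ≠ 0)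
    (hξ : ∀ t ∈ Icc 0 T, HasDerivWithinAt ξ (-(ContinuousLinearMap.adjoint (A t) (ξ t))) (Icc 0 T) t)
    (hb : ∀ t ∈ Icc 0 T, HasDerivWithinAt b (amplitudeMap (A t) (ξ t) (b t)) (Icc 0 T) t)
    (h0 : inner ℝ (b 0) (ξ 0) = 0) : ∀ t ∈ Icc 0 T, inner ℝ (b t) (ξ t) = 0 := by
  intro t ht
  have h : ∀ t ∈ Icc 0 T, HasDerivWithinAt (fun t => inner ℝ (b t) (ξ t)) 0 (Icc 0 T) t := by
    intro t ht
    have h1 := (hb t ht).inner ℝ (hξ t ht)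
    refine h1.congr_deriv ?_
    have hne : ‖ξ t‖ ≠ 0 := by simpa using hξ0 t ht
    rw [amplitudeMap_apply, inner_neg_right, ContinuousLinearMap.adjoint_inner_right,
      inner_add_left, inner_neg_left, inner_smul_left, real_inner_self_eq_norm_sq,
      real_inner_comm (A t (b t)) (ξ t)]
    simp only [conj_trivial]
    field_simp
    ring
  rw [← h0]
  exact eq_initial_of_hasDerivWithinAt_zero (fun t ht => (h t ht).continuousWithinAt)
    (fun t ht => h t (Ioo_subset_Icc_self ht)) t ht

/-- The multiples of `ξ` drop out of the determinant. With `-Aξ` in place of `-Aᵀξ` the sum would be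
`-(tr A) det`. The difference is `(A - Aᵀ)ξ = ω × ξ`, where `ω = axial A`, and `(b × c) · (ω × ξ) =
(b · ω)(c · ξ) - (b · ξ)(c · ω)` vanishes by orthogonality. -/
theorem det3_deriv_eq_zero (A : E3 →L[ℝ] E3) (b c ξ : E3) (β₁ β₂ : ℝ) (htr : tr A = 0)
    (hb : inner ℝ b ξ = 0) (hc : inner ℝ c ξ = 0) :
    det3 (-(A b) + β₁ • ξ) c ξ + det3 b (-(A c) + β₂ • ξ) ξ
      + det3 b c (-(ContinuousLinearMap.adjoint A ξ)) = 0 := by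
  rw [inner_coord] at hb hc
  simp only [det3, PiLp.add_apply, PiLp.neg_apply, PiLp.smul_apply, smul_eq_mul, adjoint_coord]
  simp only [apply_coord A]
  unfold tr at htr
  generalize entry A 0 0 = a00 at *
  generalize entry A 0 1 = a01 at *
  generalize entry A 0 2 = a02 at *
  generalize entry A 1 0 = a10 at *
  generalize entry A 1 1 = a11 at *
  generalize entry A 1 2 = a12 at *
  generalize entry A 2 0 = a20 at *
  generalize entry A 2 1 = a21 at *
  generalize entry A 2 2 = a22 at *
  generalize b 0 = b0 at *
  generalize b 1 = b1 at *
  generalize b 2 = b2 at *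
  generalize c 0 = c0 at *
  generalize c 1 = c1 at *
  generalize c 2 = c2 at *
  generalize ξ 0 = x0 at *
  generalize ξ 1 = x1 at *
  generalize ξ 2 = x2 at *
  linear_combination
    (-((b1 * c2 - b2 * c1) * x0 + (b2 * c0 - b0 * c2) * x1 + (b0 * c1 - b1 * c0) * x2)) * htr
    + ((a21 - a12) * b0 + (a02 - a20) * b1 + (a10 - a01) * b2) * hc
    - ((a21 - a12) * c0 + (a02 - a20) * c1 + (a10 - a01) * c2) * hb

theorem det3_eq_initial (hT : 0 ≤ T)
    (htr : ∀ t ∈ Ioo 0 T, tr (A t) = 0) (hξ0 : ∀ t ∈ Icc 0 T, ξ t ≠ 0)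
    (hξ : ∀ t ∈ Icc 0 T, HasDerivWithinAt ξ (-(ContinuousLinearMap.adjoint (A t) (ξ t))) (Icc 0 T) t)
    (hb : ∀ t ∈ Icc 0 T, HasDerivWithinAt b (amplitudeMap (A t) (ξ t) (b t)) (Icc 0 T) t)
    (hc : ∀ t ∈ Icc 0 T, HasDerivWithinAt c (amplitudeMap (A t) (ξ t) (c t)) (Icc 0 T) t)
    (hb0 : inner ℝ (b 0) (ξ 0) = 0) (hc0 : inner ℝ (c 0) (ξ 0) = 0) :
    det3 (b T) (c T) (ξ T) = det3 (b 0) (c 0) (ξ 0) := by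
  have hd : ∀ t ∈ Icc 0 T, HasDerivWithinAt (fun t => det3 (b t) (c t) (ξ t))
      (det3 (amplitudeMap (A t) (ξ t) (b t)) (c t) (ξ t)
        + det3 (b t) (amplitudeMap (A t) (ξ t) (c t)) (ξ t)
        + det3 (b t) (c t) (-(ContinuousLinearMap.adjoint (A t) (ξ t)))) (Icc 0 T) t := by
    intro t ht
    have B := hasDerivWithinAt_coord (hb t ht)
    have C := hasDerivWithinAt_coord (hc t ht)
    have X := hasDerivWithinAt_coord (hξ t ht)
    refine ((((((B 1).mul (C 2)).sub ((B 2).mul (C 1))).mul (X 0)).add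
      ((((B 2).mul (C 0)).sub ((B 0).mul (C 2))).mul (X 1))).add
      ((((B 0).mul (C 1)).sub ((B 1).mul (C 0))).mul (X 2))).congr_deriv ?_
    simp only [det3, Pi.mul_apply, Pi.sub_apply]
    ring
  refine eq_initial_of_hasDerivWithinAt_zero (g := fun t => det3 (b t) (c t) (ξ t))
    (fun t ht => (hd t ht).continuousWithinAt) (fun t ht => ?_) T ⟨hT, le_rfl⟩
  have ht' := Ioo_subset_Icc_self ht
  refine (hd t ht').congr_deriv ?_
  rw [amplitudeMap_apply, amplitudeMap_apply]
  exact det3_deriv_eq_zero _ _ _ _ _ _ (htr t ht)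
    (inner_amplitude_eq_zero hξ0 hξ hb hb0 t ht') (inner_amplitude_eq_zero hξ0 hξ hc hc0 t ht')

/-- Along a trajectory with velocity gradient `A`, some amplitude grows at least as the square root
of the vorticity. -/
theorem exists_amplitude (hT : 0 ≤ T) (hA : ContinuousOn A (Icc 0 T))
    (htr : ∀ t ∈ Ioo 0 T, tr (A t) = 0)
    (hω : ∀ t ∈ Ioo 0 T, HasDerivWithinAt (fun τ => axial (A τ)) (A t (axial (A t))) (Icc 0 T) t)
    (hne : axial (A T) ≠ 0) :
    ∃ ξ b : ℝ → E3,
      (∀ t ∈ Icc 0 T,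
        HasDerivWithinAt ξ (-(ContinuousLinearMap.adjoint (A t) (ξ t))) (Icc 0 T) t) ∧
      (∀ t ∈ Icc 0 T, HasDerivWithinAt b
        (-(A t (b t)) + (2 * (inner ℝ (ξ t) (A t (b t)) / ‖ξ t‖ ^ 2)) • ξ t) (Icc 0 T) t) ∧
      ‖ξ 0‖ = 1 ∧ ‖b 0‖ = 1 ∧ inner ℝ (b 0) (ξ 0) = 0 ∧
      ‖axial (A T)‖ ≤ ‖axial (A 0)‖ * ‖b T‖ ^ 2 := by
  have hAadj : ContinuousOn (fun t => -(ContinuousLinearMap.adjoint (A t))) (Icc 0 T) :=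
    (ContinuousLinearMap.adjoint.continuous.comp_continuousOn hA).neg
  -- The final value `η(T) = ω(T)` makes Cauchy–Schwarz an equality at time `T`, where it would
  -- otherwise lose.
  obtain ⟨η, hηT, hη⟩ := exists_backward_linear_solution hT hAadj (axial (A T))
  simp only [neg_apply] at hη
  have hωc : ContinuousOn (fun t => axial (A t)) (Icc 0 T) := continuous_axial.comp_continuousOn hA
  have hηc : ContinuousOn η (Icc 0 T) := fun t ht => (hη t ht).continuousWithinAt
  have hconst : ∀ t ∈ Icc 0 T, inner ℝ (axial (A t)) (η t) = inner ℝ (axial (A 0)) (η 0) := by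
    refine eq_initial_of_hasDerivWithinAt_zero (hωc.inner hηc) fun t ht => ?_
    have := (hω t ht).inner ℝ (hη t (Ioo_subset_Icc_self ht))
    refine this.congr_deriv ?_
    rw [inner_neg_right, ContinuousLinearMap.adjoint_inner_right, neg_add_cancel]
  have h0mem : (0 : ℝ) ∈ Icc 0 T := ⟨le_rfl, hT⟩
  have hTmem : T ∈ Icc 0 T := ⟨hT, le_rfl⟩
  have hval : inner ℝ (axial (A 0)) (η 0) = ‖axial (A T)‖ ^ 2 := by
    rw [← hconst T hTmem, hηT, real_inner_self_eq_norm_sq]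
  -- The conserved product `ω · η = |ω(T)|²` is nonzero, so `η` never vanishes.
  have hη0 : ∀ t ∈ Icc 0 T, η t ≠ 0 := by
    intro t ht h
    have := hconst t ht
    rw [hval, h, inner_zero_right] at this
    exact hne (by simpa using this.symm)
  have hn0 : 0 < ‖η 0‖ := norm_pos_iff.2 (hη0 0 h0mem)
  let ξ : ℝ → E3 := fun t => ‖η 0‖⁻¹ • η t
  have hξ : ∀ t ∈ Icc 0 T,
      HasDerivWithinAt ξ (-(ContinuousLinearMap.adjoint (A t) (ξ t))) (Icc 0 T) t := by
    intro t ht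
    refine ((hη t ht).const_smul ‖η 0‖⁻¹).congr_deriv ?_
    simp [ξ]
  have hξ0 : ∀ t ∈ Icc 0 T, ξ t ≠ 0 := fun t ht =>
    smul_ne_zero (inv_ne_zero hn0.ne') (hη0 t ht)
  have hξ1 : ‖ξ 0‖ = 1 := norm_smul_inv_norm (hη0 0 h0mem)
  have hξT : ‖axial (A T)‖ * ‖ξ T‖ ≤ ‖axial (A 0)‖ := by
    have h1 : ‖axial (A T)‖ * ‖ξ T‖ = inner ℝ (axial (A 0)) (ξ 0) := by
      simp only [ξ, inner_smul_right, hval, norm_smul, norm_inv, norm_norm, hηT]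
      ring
    rw [h1]
    refine (real_inner_le_norm _ _).trans ?_
    rw [hξ1, mul_one]
  have hξc : ContinuousOn ξ (Icc 0 T) := fun t ht => (hξ t ht).continuousWithinAt
  have hBc := continuousOn_amplitudeMap hA hξc hξ0
  obtain ⟨b₀, c₀, hb₀, hc₀, hbξ, hcξ, hdet⟩ := exists_frame (ξ 0) hξ1
  obtain ⟨b, hb0, hb⟩ := exists_forward_linear_solution hT hBc b₀
  obtain ⟨c, hc0, hc⟩ := exists_forward_linear_solution hT hBc c₀
  have hdetT : det3 (b T) (c T) (ξ T) = 1 := by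
    rw [det3_eq_initial hT htr hξ0 hξ hb hc (by rw [hb0, hbξ]) (by rw [hc0, hcξ]), hb0, hc0, hdet]
  have hle := det3_sq_le (b T) (c T) (ξ T)
  rw [hdetT, one_pow] at hle
  have hfinal : ∀ r : ℝ, 1 ≤ r ^ 2 * ‖ξ T‖ → ‖axial (A T)‖ ≤ ‖axial (A 0)‖ * r ^ 2 := by
    intro r hr
    calc ‖axial (A T)‖ ≤ ‖axial (A T)‖ * (r ^ 2 * ‖ξ T‖) :=
          le_mul_of_one_le_right (norm_nonneg _) hr
      _ = ‖axial (A T)‖ * ‖ξ T‖ * r ^ 2 := by ring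
      _ ≤ _ := by gcongr
  -- If both `|b|² |ξ|` and `|c|² |ξ|` were below `1` at time `T`, their product would contradict `1
  -- ≤ |b|² |c|² |ξ|²`.
  by_cases hcase : 1 ≤ ‖b T‖ ^ 2 * ‖ξ T‖
  · exact ⟨ξ, b, hξ, fun t ht => by simpa only [amplitudeMap_apply] using hb t ht, hξ1,
      by rw [hb0, hb₀], by rw [hb0, hbξ], hfinal _ hcase⟩
  · refine ⟨ξ, c, hξ, fun t ht => by simpa only [amplitudeMap_apply] using hc t ht, hξ1,
      by rw [hc0, hc₀], by rw [hc0, hcξ], hfinal _ ?_⟩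
    by_contra hcase'
    push Not at hcase hcase'
    have : (‖b T‖ ^ 2 * ‖ξ T‖) * (‖c T‖ ^ 2 * ‖ξ T‖) < 1 * 1 :=
      mul_lt_mul'' hcase hcase' (by positivity) (by positivity)
    nlinarith

end Amplitude

end EulerFlow

namespace EulerFlow

/-! ### Sobolev embedding on the whole space -/

section SpaceSobolev

/-- An `L²` function with integrable Fourier transform is given by the inversion integral. -/
theorem ae_eq_fourier_of_integrable (f : Lp C3 2 (volume : Measure E3))
    (hg : Integrable (𝓕 f : Lp C3 2 (volume : Measure E3)) (volume : Measure E3)) :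
    f =ᵐ[volume] 𝓕 (fun ξ : E3 => (𝓕 f : Lp C3 2 (volume : Measure E3)) (-ξ)) := by
  set g : Lp C3 2 (volume : Measure E3) := 𝓕 f with hgdef
  have hneg : Integrable (fun ξ : E3 => g (-ξ)) (volume : Measure E3) := hg.comp_neg
  have hcont : Continuous (𝓕 (fun ξ : E3 => g (-ξ))) :=
    VectorFourier.fourierIntegral_continuous Real.continuous_fourierChar continuous_inner hneg
  -- It suffices to test against smooth compactly supported functions. These are Schwartz, so
  -- inversion holds for tempered distributions, and Fubini moves the transform from the test
  -- function to `g`.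
  refine ae_eq_of_integral_contDiff_smul_eq ((Lp.memLp f).locallyIntegrable (by norm_num))
    hcont.locallyIntegrable fun φ hφ hφc => ?_
  have hc : HasCompactSupport (Complex.ofRealCLM ∘ φ) := hφc.comp_left rfl
  have hs : ContDiff ℝ ∞ (Complex.ofRealCLM ∘ φ) := by fun_prop
  let ψ : SchwartzMap E3 ℂ := hc.toSchwartzMap hs
  have hψ : ∀ x, ψ x = (φ x : ℂ) := fun x => rfl
  have hinv : Lp.toTemperedDistribution f ψ = Lp.toTemperedDistribution g (𝓕⁻ ψ) := by
    have h1 := Lp.fourierInv_toTemperedDistribution_eq g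
    have h2 : (𝓕⁻ g : Lp C3 2 (volume : Measure E3)) = f :=
      FourierTransform.fourierInv_fourier_eq f
    rw [h2] at h1
    rw [← h1]
    rfl
  rw [Lp.toTemperedDistribution_apply, Lp.toTemperedDistribution_apply] at hinv
  simp only [hψ, Complex.coe_smul] at hinv
  rw [hinv]
  calc ∫ ξ, (𝓕⁻ ψ) ξ • g ξ = ∫ ξ, (𝓕 (ψ : E3 → ℂ)) (-ξ) • g ξ := by
        refine integral_congr_ae (Eventually.of_forall fun ξ => ?_)
        simp only
        rw [SchwartzMap.fourierInv_coe, Real.fourierInv_eq_fourier_neg]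
    _ = ∫ ξ, (𝓕 (ψ : E3 → ℂ)) ξ • g (-ξ) := by
        rw [← integral_neg_eq_self]
        simp only [neg_neg]
    _ = ∫ x, ψ x • 𝓕 (fun ξ : E3 => g (-ξ)) x :=
        by simpa using! (VectorFourier.integral_fourierIntegral_smul_eq_flip (μ := volume)
          (ν := volume) (L := innerₗ E3) Real.continuous_fourierChar continuous_inner
          ψ.integrable hneg)
    _ = _ := by simp only [hψ, Complex.coe_smul]

/-- The real part of a complex vector. -/
noncomputable def rePart : C3 →L[ℝ] E3 :=
  ((PiLp.continuousLinearEquiv 2 ℝ fun _ : Fin 3 => ℝ).symm : (Fin 3 → ℝ) →L[ℝ] E3).comp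
    (ContinuousLinearMap.pi fun i =>
      Complex.reCLM.comp ((EuclideanSpace.proj i : C3 →L[ℂ] ℂ).restrictScalars ℝ))

theorem rePart_complexify (f : E3 → E3) (x : E3) : rePart (complexify f x) = f x := by
  ext i
  simp [rePart, complexify]

theorem norm_fourier_le_integral (k : E3 → C3) (x : E3) : ‖𝓕 k x‖ ≤ ∫ v, ‖k v‖ :=
  VectorFourier.norm_fourierIntegral_le_integral_norm _ _ _ _ _

/-- The square of the weight is `(1 + |ξ|²)^{-(s-2)}`, integrable in dimension three because `2s - 4
> 3`. -/
theorem memLp_sobolev_weight {s : ℝ} (hs : 7 / 2 < s) :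
    MemLp (fun ξ : E3 => (1 + ‖ξ‖ ^ 2 : ℝ) ^ (1 - s / 2)) 2 (volume : Measure E3) := by
  have hm : Continuous (fun ξ : E3 => (1 + ‖ξ‖ ^ 2 : ℝ) ^ (1 - s / 2)) :=
    Continuous.rpow_const (by fun_prop) fun x => Or.inl (by positivity)
  rw [memLp_two_iff_integrable_sq hm.aestronglyMeasurable]
  have h := integrable_rpow_neg_one_add_norm_sq (E := E3) (μ := volume) (r := 2 * s - 4)
    (by simp; linarith)
  refine h.congr (Eventually.of_forall fun ξ => ?_)
  simp only
  rw [← Real.rpow_mul_natCast (by positivity)]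
  congr 1
  push_cast
  ring

/-- Functions in a weighted `L²` space of order `s > 7/2` have integrable moments of order two. -/
theorem integrable_moments {s : ℝ} (hs : 7 / 2 < s) :
    ∃ C : ℝ, 0 ≤ C ∧ ∀ (g : E3 → C3) (r : ℝ), 0 ≤ r → AEStronglyMeasurable g (volume : Measure E3) →
      eLpNorm (fun ξ : E3 => ((1 + ‖ξ‖ ^ 2) ^ (s / 2) : ℝ) • g ξ) 2 (volume : Measure E3)
        < ENNReal.ofReal r →
      ∀ n : ℕ, n ≤ 2 → Integrable (fun ξ => ‖ξ‖ ^ n * ‖g ξ‖) (volume : Measure E3) ∧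
        ∫ ξ, ‖ξ‖ ^ n * ‖g ξ‖ ≤ C * r := by
  set w : E3 → ℝ := fun ξ => (1 + ‖ξ‖ ^ 2 : ℝ) ^ (1 - s / 2) with hw
  have hwL : MemLp w 2 (volume : Measure E3) := memLp_sobolev_weight hs
  refine ⟨(eLpNorm w 2 (volume : Measure E3)).toReal, ENNReal.toReal_nonneg,
    fun g r hr hgm hf n hn => ?_⟩
  set G : E3 → C3 := fun ξ => ((1 + ‖ξ‖ ^ 2) ^ (s / 2) : ℝ) • g ξ with hG
  have hwc : ∀ p : ℝ, Continuous (fun ξ : E3 => (1 + ‖ξ‖ ^ 2 : ℝ) ^ p) := fun p =>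
    Continuous.rpow_const (by fun_prop) fun x => Or.inl (by positivity)
  have hGm : AEStronglyMeasurable G (volume : Measure E3) :=
    (hwc _).aestronglyMeasurable.smul hgm
  have hGL : MemLp G 2 (volume : Measure E3) := ⟨hGm, hf.trans ENNReal.ofReal_lt_top⟩
  -- The weights multiply to `1 + |ξ|²`, which dominates all moments up to order two; the Hölder
  -- inequality bounds the `L¹` norm of `H`.
  set H : E3 → C3 := w • G with hH
  have hHL : MemLp H 1 (volume : Measure E3) := hGL.smul hwL
  have hHint : Integrable H (volume : Measure E3) := memLp_one_iff_integrable.1 hHL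
  have hHn : ∀ ξ, ‖H ξ‖ = (1 + ‖ξ‖ ^ 2) * ‖g ξ‖ := fun ξ => by
    simp only [hH, hG, hw, Pi.smul_apply', norm_smul, ← mul_assoc, Real.norm_eq_abs]
    rw [← abs_mul, ← Real.rpow_add (by positivity), sub_add_cancel, Real.rpow_one,
      abs_of_nonneg (by positivity)]
  have hHbound : ∫ ξ, ‖H ξ‖ ≤ (eLpNorm w 2 (volume : Measure E3)).toReal * r := by
    have h1 : eLpNorm H 1 (volume : Measure E3) ≤ eLpNorm w 2 volume * eLpNorm G 2 volume :=
      eLpNorm_smul_le_mul_eLpNorm (p := 2) (q := 2) (r := 1) hGm hwL.1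
    rw [integral_norm_eq_lintegral_enorm hHint.1, ← eLpNorm_one_eq_lintegral_enorm]
    calc (eLpNorm H 1 (volume : Measure E3)).toReal
        ≤ (eLpNorm w 2 (volume : Measure E3) * ENNReal.ofReal r).toReal := by
          refine ENNReal.toReal_mono ?_ (h1.trans (by gcongr))
          exact ENNReal.mul_ne_top hwL.2.ne ENNReal.ofReal_ne_top
      _ = _ := by rw [ENNReal.toReal_mul, ENNReal.toReal_ofReal hr]
  have hpow : ∀ ξ : E3, ‖ξ‖ ^ n * ‖g ξ‖ ≤ ‖H ξ‖ := by
    intro ξ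
    rw [hHn]
    have := norm_nonneg ξ
    gcongr
    interval_cases n <;> nlinarith [sq_nonneg (‖ξ‖ - 1), sq_nonneg ‖ξ‖]
  have hint : Integrable (fun ξ => ‖ξ‖ ^ n * ‖g ξ‖) (volume : Measure E3) := by
    refine hHint.mono ((by fun_prop : Continuous fun ξ : E3 => ‖ξ‖ ^ n).aestronglyMeasurable.mul
      hgm.norm) (Eventually.of_forall fun ξ => ?_)
    rw [Real.norm_eq_abs, abs_of_nonneg (by positivity)]
    exact hpow ξ
  exact ⟨hint, (integral_mono hint hHint.norm hpow).trans hHbound⟩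

/-- The Fourier integral of a function with integrable second moments. -/
theorem contDiff_rePart_fourier {k : E3 → C3} (hkm : AEStronglyMeasurable k (volume : Measure E3))
    {B : ℝ} (hk : ∀ n : ℕ, n ≤ 2 → Integrable (fun ξ => ‖ξ‖ ^ n * ‖k ξ‖) (volume : Measure E3) ∧
      ∫ ξ, ‖ξ‖ ^ n * ‖k ξ‖ ≤ B) :
    ContDiff ℝ 2 (fun x => rePart (𝓕 k x)) ∧
      (∀ x, ‖rePart (𝓕 k x)‖ ≤ ‖rePart‖ * B) ∧
      ∀ x, ‖fderiv ℝ (fun x => rePart (𝓕 k x)) x‖ ≤ ‖rePart‖ * (2 * Real.pi * B) := by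
  have hk0 : Integrable k (volume : Measure E3) := by
    refine (integrable_norm_iff hkm).1 ?_
    simpa using (hk 0 (by norm_num)).1
  have hk1 : Integrable (fun ξ => ‖ξ‖ * ‖k ξ‖) (volume : Measure E3) := by
    simpa using (hk 1 (by norm_num)).1
  have hCD : ContDiff ℝ 2 (𝓕 k) :=
    Real.contDiff_fourier (N := 2) fun n hn => (hk n (by exact_mod_cast hn)).1
  refine ⟨rePart.contDiff.comp hCD, fun x => ?_, fun x => ?_⟩
  · refine rePart.le_opNorm_of_le ((norm_fourier_le_integral k x).trans ?_)
    simpa using (hk 0 (by norm_num)).2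
  · have hd : HasFDerivAt (𝓕 k) (𝓕 (VectorFourier.fourierSMulRight (innerSL ℝ) k) x) x :=
      Real.hasFDerivAt_fourier hk0 hk1 x
    have hd' := rePart.hasFDerivAt.comp x hd
    have hb : ‖𝓕 (VectorFourier.fourierSMulRight (innerSL ℝ) k) x‖ ≤ 2 * Real.pi * B := by
      refine (VectorFourier.norm_fourierIntegral_le_integral_norm _ _ _ _ _).trans ?_
      have : ∀ ξ, ‖VectorFourier.fourierSMulRight (innerSL ℝ) k ξ‖
          ≤ 2 * Real.pi * (‖ξ‖ ^ 1 * ‖k ξ‖) := by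
        intro ξ
        refine (VectorFourier.norm_fourierSMulRight_le _ _ _).trans ?_
        rw [pow_one]
        have h1 : ‖innerSL ℝ (E := E3)‖ ≤ 1 := norm_innerSL_le _
        have h2 : 0 ≤ 2 * Real.pi * (‖ξ‖ * ‖k ξ‖) := by positivity
        nlinarith
      refine (integral_mono_of_nonneg (Eventually.of_forall fun _ => norm_nonneg _)
        ((hk 1 (by norm_num)).1.const_mul (2 * Real.pi)) (Eventually.of_forall this)).trans ?_
      rw [integral_const_mul]
      gcongr
      exact (hk 1 (by norm_num)).2
    have : fderiv ℝ (fun x => rePart (𝓕 k x)) x = _ := hd'.fderiv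
    rw [this]
    exact (ContinuousLinearMap.opNorm_comp_le _ _).trans (by gcongr)

/-- Sobolev embedding `H^s(ℝ³) ⊂ C²` for `s > 7/2`, with bounds on the function and its first
derivative. -/
theorem exists_space_representative {s : ℝ} (hs : 7 / 2 < s) :
    ∃ C : ℝ, 0 ≤ C ∧ ∀ (f : E3 → E3) (r : ℝ), 0 ≤ r → spaceSobolevNorm s f < ENNReal.ofReal r →
      ∃ F : E3 → E3, ContDiff ℝ 2 F ∧ F =ᵐ[volume] f ∧ (∀ x, ‖F x‖ ≤ C * r) ∧
        ∀ x, ‖fderiv ℝ F x‖ ≤ C * r := by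
  obtain ⟨C₀, hC₀, hmom⟩ := integrable_moments hs
  -- The factor `2π` comes from differentiating the Fourier kernel; being at least `1`, it also
  -- serves for the function itself.
  refine ⟨‖rePart‖ * (2 * Real.pi * C₀), by positivity, fun f r hr hf => ?_⟩
  rw [spaceSobolevNorm, iInf_lt_iff] at hf
  obtain ⟨h, hf⟩ := hf
  have hgm := Lp.aestronglyMeasurable (𝓕 (h.toLp (complexify f)) : Lp C3 2 (volume : Measure E3))
  have hg := hmom _ r hr hgm hf
  have hgint : Integrable (𝓕 (h.toLp (complexify f)) : Lp C3 2 (volume : Measure E3))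
      (volume : Measure E3) := by
    refine (integrable_norm_iff hgm).1 ?_
    simpa using (hg 0 (by norm_num)).1
  have hae := ae_eq_fourier_of_integrable (h.toLp (complexify f)) hgint
  generalize (⇑(𝓕 (h.toLp (complexify f)) : Lp C3 2 (volume : Measure E3)) : E3 → C3) = g at *
  have hk := contDiff_rePart_fourier (k := fun ξ => g (-ξ)) (B := C₀ * r)
    (hgm.comp_quasiMeasurePreserving (Measure.measurePreserving_neg _).quasiMeasurePreserving)
    (fun n hn => by
      have h1 := (hg n hn).1.comp_neg
      have h2 := integral_neg_eq_self (fun ξ => ‖ξ‖ ^ n * ‖g ξ‖) (volume : Measure E3)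
      simp only [norm_neg] at h1 h2
      exact ⟨h1, h2.trans_le (hg n hn).2⟩)
  have hp : 1 ≤ 2 * Real.pi := by linarith [Real.pi_gt_three]
  refine ⟨_, hk.1, ?_, fun x => (hk.2.1 x).trans ?_, fun x => (hk.2.2 x).trans (le_of_eq (by ring))⟩
  · filter_upwards [hae, h.coeFn_toLp] with x hx1 hx2
    rw [← rePart_complexify f x, ← hx2, hx1]
  · have h0 : 0 ≤ ‖rePart‖ * (C₀ * r) := by positivity
    nlinarith

end SpaceSobolev

end EulerFlow

namespace EulerFlow

/-! ### Weighted sums over the integer lattice -/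

section LatticeSums

/-- The squared Euclidean norm of a lattice point. -/
def sqNorm (k : Fin 3 → ℤ) : ℝ := ∑ i, (k i : ℝ) ^ 2

theorem sqNorm_nonneg (k : Fin 3 → ℤ) : 0 ≤ sqNorm k := by
  unfold sqNorm
  positivity

theorem summable_one_add_sq_rpow {p : ℝ} (hp : 1 / 2 < p) :
    Summable fun n : ℤ => (1 + (n : ℝ) ^ 2) ^ (-p) := by
  have h1 : Summable fun n : ℤ => |(n : ℝ)| ^ (-(2 * p)) :=
    Real.summable_abs_int_rpow (by linarith)
  -- The comparison series has the value `0` at `n = 0`, since `0` to a nonzero real power is `0` by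
  -- convention; this corrects that single term.
  have h2 : Summable fun n : ℤ => if n = 0 then (1 : ℝ) else 0 := (hasSum_ite_eq 0 1).summable
  refine Summable.of_nonneg_of_le (fun n => by positivity) (fun n => ?_) (h1.add h2)
  by_cases hn : n = 0
  · subst hn
    simp only [Int.cast_zero, if_true]
    norm_num
    positivity
  · simp only [if_neg hn, add_zero]
    have hpos : 0 < |(n : ℝ)| := by positivity
    rw [neg_mul_eq_mul_neg, Real.rpow_mul hpos.le, Real.rpow_ofNat, sq_abs]
    exact Real.rpow_le_rpow_of_nonpos (by positivity) (by linarith) (by linarith)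

/-- Each `1 + kᵢ²` is at most `1 + |k|²`, so the term is bounded by a product of three
one-dimensional terms of exponent `q/3 > 1/2`. -/
theorem summable_lattice_rpow {q : ℝ} (hq : 3 / 2 < q) :
    Summable fun k : Fin 3 → ℤ => (1 + sqNorm k) ^ (-q) := by
  have h1 := summable_one_add_sq_rpow (p := q / 3) (by linarith)
  have hn : ∀ n : ℤ, 0 ≤ (1 + (n : ℝ) ^ 2) ^ (-(q / 3)) := fun n => by positivity
  have h2 := (h1.mul_of_nonneg (h1.mul_of_nonneg h1 hn hn) hn
    (fun x => mul_nonneg (hn _) (hn _))).comp_injective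
    (i := fun k : Fin 3 → ℤ => (k 0, k 1, k 2)) (fun k l h => by
      simp only [Prod.mk.injEq] at h
      ext i
      fin_cases i
      exacts [h.1, h.2.1, h.2.2])
  refine Summable.of_nonneg_of_le (fun k => ?_) (fun k => ?_) h2
  · have := sqNorm_nonneg k
    positivity
  · have h0 := sqNorm_nonneg k
    have hX : ∀ i, 1 + (k i : ℝ) ^ 2 ≤ 1 + sqNorm k := fun i => by
      gcongr
      exact Finset.single_le_sum (f := fun i => (k i : ℝ) ^ 2) (fun _ _ => sq_nonneg _)
        (Finset.mem_univ i)
    have hY : ∀ i, (1 + sqNorm k) ^ (-(q / 3)) ≤ (1 + (k i : ℝ) ^ 2) ^ (-(q / 3)) := fun i =>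
      Real.rpow_le_rpow_of_nonpos (by positivity) (hX i) (by linarith)
    have : (1 + sqNorm k) ^ (-q) = (1 + sqNorm k) ^ (-(q / 3)) *
        ((1 + sqNorm k) ^ (-(q / 3)) * (1 + sqNorm k) ^ (-(q / 3))) := by
      rw [← Real.rpow_add (by positivity), ← Real.rpow_add (by positivity)]
      congr 1
      ring
    rw [this]
    simp only [Function.comp]
    have hZ : 0 ≤ (1 + sqNorm k) ^ (-(q / 3)) := (Real.rpow_pos_of_pos (by linarith) _).le
    exact mul_le_mul (hY 0) (mul_le_mul (hY 1) (hY 2) hZ (hn _)) (mul_nonneg hZ hZ) (hn _)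

/-- Sequences in a weighted `ℓ²` space of order `s > 7/2` have summable second moments. -/
theorem summable_moments {s : ℝ} (hs : 7 / 2 < s) :
    ∃ C : ℝ, 0 ≤ C ∧ ∀ (c : (Fin 3 → ℤ) → C3) (r : ℝ), 0 ≤ r →
      (∑' k : Fin 3 → ℤ, ENNReal.ofReal ((1 + ∑ i, (k i : ℝ) ^ 2) ^ s) * ‖c k‖ₑ ^ 2) ^ (1 / 2 : ℝ)
        < ENNReal.ofReal r →
      Summable (fun k => (1 + sqNorm k) * ‖c k‖) ∧ ∑' k, (1 + sqNorm k) * ‖c k‖ ≤ C * r := by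
  have hsum := summable_lattice_rpow (q := s - 2) (by linarith)
  have hpos : ∀ k, 0 < 1 + sqNorm k := fun k => by linarith [sqNorm_nonneg k]
  refine ⟨(∑' k, (1 + sqNorm k) ^ (-(s - 2))) ^ (1 / 2 : ℝ), ?_, fun c r hr hc => ?_⟩
  · exact Real.rpow_nonneg (tsum_nonneg fun k => (Real.rpow_pos_of_pos (hpos k) _).le) _
  set a : (Fin 3 → ℤ) → ℝ := fun k => (1 + sqNorm k) ^ (s / 2) * ‖c k‖ with ha
  set w : (Fin 3 → ℤ) → ℝ := fun k => (1 + sqNorm k) ^ (1 - s / 2) with hw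
  have ha0 : ∀ k, 0 ≤ a k := fun k =>
    mul_nonneg (Real.rpow_pos_of_pos (hpos k) _).le (norm_nonneg _)
  have hw0 : ∀ k, 0 ≤ w k := fun k => (Real.rpow_pos_of_pos (hpos k) _).le
  have hw2 : ∀ k, w k ^ (2 : ℝ) = (1 + sqNorm k) ^ (-(s - 2)) := fun k => by
    rw [hw, ← Real.rpow_mul (hpos k).le]
    congr 1
    ring
  have hterm : ∀ k : Fin 3 → ℤ, ENNReal.ofReal ((1 + ∑ i, (k i : ℝ) ^ 2) ^ s) * ‖c k‖ₑ ^ 2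
      = ENNReal.ofReal (a k ^ (2 : ℝ)) := by
    intro k
    change ENNReal.ofReal ((1 + sqNorm k) ^ s) * _ = _
    rw [← ofReal_norm, ← ENNReal.ofReal_pow (norm_nonneg _),
      ← ENNReal.ofReal_mul (Real.rpow_pos_of_pos (hpos k) _).le]
    congr 1
    rw [ha, Real.mul_rpow (Real.rpow_pos_of_pos (hpos k) _).le (norm_nonneg _),
      ← Real.rpow_mul (hpos k).le, Real.rpow_two, div_mul_cancel₀ _ two_ne_zero]
  simp only [hterm] at hc
  have hc2 : ∑' k, ENNReal.ofReal (a k ^ (2 : ℝ)) < ENNReal.ofReal (r ^ 2) := by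
    have := ENNReal.rpow_lt_rpow hc (z := 2) (by norm_num)
    rw [← ENNReal.rpow_mul, ENNReal.ofReal_rpow_of_nonneg hr (by norm_num)] at this
    simpa using this
  have ha2n : ∀ k, 0 ≤ a k ^ (2 : ℝ) := fun k => Real.rpow_nonneg (ha0 k) _
  have ha2 : Summable fun k => a k ^ (2 : ℝ) := by
    have := ENNReal.summable_toReal (hc2.trans ENNReal.ofReal_lt_top).ne
    exact this.congr fun k => ENNReal.toReal_ofReal (ha2n k)
  have ha2r : ∑' k, a k ^ (2 : ℝ) ≤ r ^ 2 := by
    rw [← ENNReal.ofReal_tsum_of_nonneg ha2n ha2] at hc2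
    exact ((ENNReal.ofReal_lt_ofReal_iff_of_nonneg (tsum_nonneg ha2n)).1 hc2).le
  have hw2s : Summable fun k => w k ^ (2 : ℝ) := by simpa only [hw2] using hsum
  -- Cauchy–Schwarz, with `w a = (1 + |k|²) |c|` and `w² = (1 + |k|²)^{-(s-2)}`, summable because `s
  -- - 2 > 3/2`.
  obtain ⟨h1, h2⟩ := Real.summable_and_inner_le_Lp_mul_Lq_tsum_of_nonneg
    (Real.HolderConjugate.two_two) hw0 ha0 hw2s ha2
  have hprod : ∀ k, w k * a k = (1 + sqNorm k) * ‖c k‖ := fun k => by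
    rw [hw, ha, ← mul_assoc, ← Real.rpow_add (hpos k), sub_add_cancel, Real.rpow_one]
  simp only [hprod, hw2] at h1 h2
  refine ⟨h1, h2.trans ?_⟩
  refine mul_le_mul_of_nonneg_left ?_ (Real.rpow_nonneg
    (tsum_nonneg fun k => (Real.rpow_pos_of_pos (hpos k) _).le) _)
  calc (∑' k, a k ^ (2 : ℝ)) ^ (1 / 2 : ℝ) ≤ (r ^ 2) ^ (1 / 2 : ℝ) := by
        exact Real.rpow_le_rpow (tsum_nonneg ha2n) ha2r (by norm_num)
    _ = r := by rw [← Real.sqrt_eq_rpow, Real.sqrt_sq hr]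

end LatticeSums

/-! ### Smoothness of vector-valued Fourier series -/

section FourierSeries

theorem iteratedDeriv_cexp_I (n : ℕ) :
    iteratedDeriv n (fun t : ℝ => Complex.exp (Complex.I * t))
      = fun t : ℝ => Complex.I ^ n * Complex.exp (Complex.I * t) := by
  induction n with
  | zero => simp
  | succ n ih =>
    rw [iteratedDeriv_succ, ih]
    ext t
    have h1 : HasDerivAt (fun t : ℝ => Complex.I * (t : ℂ)) Complex.I t := by
      simpa using (Complex.ofRealCLM.hasDerivAt (x := t)).const_mul Complex.I
    rw [(h1.cexp.const_mul (Complex.I ^ n)).deriv]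
    ring

/-- The phase of the `k`-th Fourier mode. -/
noncomputable def phase (k : Fin 3 → ℤ) : E3 →L[ℝ] ℝ :=
  (2 * Real.pi) • innerSL ℝ (WithLp.toLp 2 fun i => (k i : ℝ) : E3)

theorem phase_apply (k : Fin 3 → ℤ) (x : E3) : phase k x = 2 * Real.pi * ∑ i, (k i : ℝ) * x i := by
  simp [phase, PiLp.inner_apply, mul_comm]

theorem norm_phase_sq (k : Fin 3 → ℤ) : ‖phase k‖ ^ 2 = (2 * Real.pi) ^ 2 * sqNorm k := by
  rw [phase, norm_smul, mul_pow, innerSL_apply_norm, EuclideanSpace.real_norm_sq_eq,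
    Real.norm_eq_abs, sq_abs]
  rfl

/-- A vector-valued Fourier mode. -/
noncomputable def mode (k : Fin 3 → ℤ) (c : C3) (x : E3) : C3 :=
  Complex.exp (Complex.I * (phase k x : ℝ)) • c

theorem contDiff_mode (k : Fin 3 → ℤ) (c : C3) : ContDiff ℝ 2 (mode k c) := by
  unfold mode
  exact ((contDiff_const.mul (Complex.ofRealCLM.contDiff.comp (phase k).contDiff)).cexp).smul
    contDiff_const

/-- A mode is `t ↦ e^{it}` between two linear maps, so its derivative of order `n` is at most
`‖phase k‖ ^ n * ‖c‖`. A common majorant for all orders up to two lets one summability hypothesis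
control them together. -/
theorem norm_iteratedFDeriv_mode_le (k : Fin 3 → ℤ) (c : C3) (x : E3) {n : ℕ} (hn : n ≤ 2) :
    ‖iteratedFDeriv ℝ n (mode k c) x‖ ≤ (2 * Real.pi) ^ 2 * ((1 + sqNorm k) * ‖c‖) := by
  let e : ℝ → ℂ := fun t => Complex.exp (Complex.I * t)
  have he : ContDiff ℝ 2 e :=
    (contDiff_const.mul Complex.ofRealCLM.contDiff).cexp
  let M : ℂ →L[ℝ] C3 := (ContinuousLinearMap.id ℝ ℂ).smulRight c
  have hmode : mode k c = M ∘ (e ∘ phase k) := rfl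
  have hM : ‖M‖ ≤ ‖c‖ := by
    refine ContinuousLinearMap.opNorm_le_bound _ (norm_nonneg _) fun z => ?_
    simp [M, norm_smul, mul_comm]
  have hn' : (n : ℕ∞ω) ≤ 2 := by exact_mod_cast hn
  have h1 : ‖iteratedFDeriv ℝ n (e ∘ phase k) x‖ ≤ ‖phase k‖ ^ n := by
    rw [(phase k).iteratedFDeriv_comp_right he x hn']
    refine (ContinuousMultilinearMap.norm_compContinuousLinearMap_le _ _).trans ?_
    rw [norm_iteratedFDeriv_eq_norm_iteratedDeriv, iteratedDeriv_cexp_I, Finset.prod_const,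
      Finset.card_univ, Fintype.card_fin, norm_mul, norm_pow, Complex.norm_I, one_pow, one_mul,
      mul_comm Complex.I, Complex.norm_exp_ofReal_mul_I, one_mul]
  have h2 : ‖phase k‖ ^ n ≤ (2 * Real.pi) ^ 2 * (1 + sqNorm k) := by
    have hp : ‖phase k‖ ^ n ≤ 1 + ‖phase k‖ ^ 2 := by
      have := norm_nonneg (phase k)
      interval_cases n <;> nlinarith [sq_nonneg (‖phase k‖ - 1), sq_nonneg ‖phase k‖]
    rw [norm_phase_sq] at hp
    have hpi : 1 ≤ (2 * Real.pi) ^ 2 := by nlinarith [Real.pi_gt_three]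
    linarith
  rw [hmode]
  calc _ ≤ ‖M‖ * ‖iteratedFDeriv ℝ n (e ∘ phase k) x‖ :=
        M.norm_iteratedFDeriv_comp_left (he.comp (phase k).contDiff).contDiffAt hn'
    _ ≤ ‖c‖ * ((2 * Real.pi) ^ 2 * (1 + sqNorm k)) := by
        gcongr
        exact h1.trans h2
    _ = _ := by ring

theorem mode_add_single (k : Fin 3 → ℤ) (c : C3) (x : E3) (i : Fin 3) :
    mode k c (x + EuclideanSpace.single i 1) = mode k c x := by
  have h : phase k (x + EuclideanSpace.single i 1) = phase k x + k i * (2 * Real.pi) := by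
    rw [map_add]
    congr 1
    rw [phase_apply]
    simp [mul_comm]
  unfold mode
  rw [h]
  congr 1
  rw [Complex.exp_eq_exp_iff_exists_int]
  refine ⟨k i, ?_⟩
  push_cast
  ring

/-- The sum of a vector-valued Fourier series. -/
noncomputable def fourierSum (c : (Fin 3 → ℤ) → C3) (x : E3) : C3 := ∑' k, mode k (c k) x

theorem fourierSum_properties {c : (Fin 3 → ℤ) → C3} {B : ℝ}
    (hc : Summable fun k => (1 + sqNorm k) * ‖c k‖) (hB : ∑' k, (1 + sqNorm k) * ‖c k‖ ≤ B) :
    ContDiff ℝ 2 (fourierSum c) ∧ (∀ x, ‖fourierSum c x‖ ≤ (2 * Real.pi) ^ 2 * B) ∧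
      ∀ x, ‖fderiv ℝ (fourierSum c) x‖ ≤ (2 * Real.pi) ^ 2 * B := by
  have hv := hc.mul_left ((2 * Real.pi) ^ 2)
  have hcd : ContDiff ℝ ((2 : ℕ∞) : ℕ∞ω) (fourierSum c) :=
    contDiff_tsum (v := fun _ k => (2 * Real.pi) ^ 2 * ((1 + sqNorm k) * ‖c k‖))
      (fun k => contDiff_mode k (c k)) (fun _ _ => hv)
      (fun n k x hn => norm_iteratedFDeriv_mode_le k (c k) x (by exact_mod_cast hn))
  have hder : ∀ n : ℕ, n ≤ 2 → ∀ x, ‖iteratedFDeriv ℝ n (fourierSum c) x‖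
      ≤ (2 * Real.pi) ^ 2 * B := by
    intro n hn x
    have := iteratedFDeriv_tsum (𝕜 := ℝ) (N := (2 : ℕ∞)) (f := fun k => mode k (c k))
      (v := fun _ k => (2 * Real.pi) ^ 2 * ((1 + sqNorm k) * ‖c k‖))
      (fun k => contDiff_mode k (c k)) (fun _ _ => hv)
      (fun n k x hn => norm_iteratedFDeriv_mode_le k (c k) x (by exact_mod_cast hn))
      (k := n) (by exact_mod_cast hn)
    change ‖iteratedFDeriv ℝ n (fun x => ∑' k, mode k (c k) x) x‖ ≤ _
    rw [this]
    refine (tsum_of_norm_bounded hv.hasSum fun k => norm_iteratedFDeriv_mode_le k (c k) x hn).trans ?_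
    rw [tsum_mul_left]
    gcongr
  refine ⟨hcd, fun x => ?_, fun x => ?_⟩
  · simpa using hder 0 (by norm_num) x
  · rw [← norm_iteratedFDeriv_one]
    exact hder 1 (by norm_num) x

end FourierSeries

end EulerFlow

namespace EulerFlow

/-! ### Sobolev embedding on the torus -/

section TorusSobolev

attribute [local instance] instMeasureSpaceUnitAddCircle

/-- The unit cube. -/
def unitCube : Set E3 := {x | ∀ i, x i ∈ Ico (0 : ℝ) 1}

/-- The projection of `ℝ³` onto the torus. -/
def torusProj (x : E3) : UnitAddTorus (Fin 3) := fun i => (x i : UnitAddCircle)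

theorem torusRep_torusProj {x : E3} (hx : x ∈ unitCube) : torusRep (torusProj x) = x := by
  ext i
  simpa [torusRep, torusProj] using hx i

theorem measurableSet_unitCube : MeasurableSet unitCube := by
  have : unitCube = ⋂ i, (fun x : E3 => x i) ⁻¹' Ico 0 1 := by
    ext x
    simp [unitCube]
  rw [this]
  exact MeasurableSet.iInter fun i => measurableSet_Ico.preimage (by fun_prop)

theorem measurePreserving_circle :
    MeasurePreserving (QuotientAddGroup.mk : ℝ → UnitAddCircle)
      ((volume : Measure ℝ).restrict (Ico 0 1)) AddCircle.haarAddCircle := by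
  have h := AddCircle.measurePreserving_mk 1 0
  rw [zero_add, Measure.restrict_congr_set (Ico_ae_eq_Ioc (a := (0 : ℝ)) (b := 1)).symm,
    AddCircle.volume_eq_smul_haarAddCircle, ENNReal.ofReal_one, one_smul] at h
  exact h

theorem measurePreserving_torusProj :
    MeasurePreserving torusProj ((volume : Measure E3).restrict unitCube)
      (volume : Measure (UnitAddTorus (Fin 3))) := by
  have h1 : MeasurePreserving (fun (x : Fin 3 → ℝ) (i : Fin 3) => (x i : UnitAddCircle))
      (Measure.pi fun _ => (volume : Measure ℝ).restrict (Ico 0 1))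
      (Measure.pi fun _ => AddCircle.haarAddCircle) :=
    measurePreserving_pi _ _ fun _ => measurePreserving_circle
  rw [← Measure.restrict_pi_pi] at h1
  have h2 := (PiLp.volume_preserving_ofLp (Fin 3)).restrict_preimage
    (MeasurableSet.univ_pi fun _ => measurableSet_Ico (a := (0 : ℝ)) (b := 1))
  have hset : (WithLp.ofLp : E3 → Fin 3 → ℝ) ⁻¹' (univ.pi fun _ => Ico (0 : ℝ) 1) = unitCube := by
    ext x
    simp [unitCube]
  rw [hset] at h2
  exact h1.comp h2

theorem measurable_torusRep : Measurable torusRep := by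
  unfold torusRep
  refine (WithLp.measurable_toLp 2 _).comp (measurable_pi_lambda _ fun i => ?_)
  exact measurable_subtype_coe.comp
    ((AddCircle.measurableEquivIco 1 0).measurable.comp (measurable_pi_apply i))

/-- The map inverts the measure-preserving projection on the unit cube. It transfers square
integrability from the cube to the torus, where the Fourier coefficients are defined. -/
theorem measurePreserving_torusRep :
    MeasurePreserving torusRep (volume : Measure (UnitAddTorus (Fin 3)))
      ((volume : Measure E3).restrict unitCube) := by
  refine ⟨measurable_torusRep, ?_⟩
  rw [← measurePreserving_torusProj.map_eq,
    Measure.map_map measurable_torusRep measurePreserving_torusProj.measurable]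
  have : torusRep ∘ torusProj =ᵐ[(volume : Measure E3).restrict unitCube] id := by
    filter_upwards [ae_restrict_mem measurableSet_unitCube] with x hx
    exact torusRep_torusProj hx
  rw [Measure.map_congr this, Measure.map_id]

theorem isProbabilityMeasure_torus :
    IsProbabilityMeasure (volume : Measure (UnitAddTorus (Fin 3))) :=
  inferInstanceAs (IsProbabilityMeasure
    (Measure.pi fun _ : Fin 3 => (AddCircle.haarAddCircle : Measure UnitAddCircle)))

theorem mFourier_torusProj (k : Fin 3 → ℤ) (x : E3) :
    UnitAddTorus.mFourier k (torusProj x) = Complex.exp (Complex.I * (phase k x : ℝ)) := by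
  simp only [UnitAddTorus.mFourier, torusProj, ContinuousMap.coe_mk, fourier_coe_apply]
  rw [← Complex.exp_sum, phase_apply]
  congr 1
  push_cast
  rw [Finset.mul_sum, Finset.mul_sum]
  refine Finset.sum_congr rfl fun i _ => ?_
  simp
  ring

/-- A square integrable function on the torus with summable Fourier coefficients is the sum of its
Fourier series. -/
theorem ae_eq_tsum_mFourier {φ : UnitAddTorus (Fin 3) → ℂ}
    (hφ : MemLp φ 2 (volume : Measure (UnitAddTorus (Fin 3))))
    (hc : Summable fun k => ‖UnitAddTorus.mFourierCoeff φ k‖) :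
    ∀ᵐ y, HasSum (fun k => UnitAddTorus.mFourierCoeff φ k * UnitAddTorus.mFourier k y) (φ y) := by
  have := isProbabilityMeasure_torus
  have hcoef : ∀ k, UnitAddTorus.mFourierCoeff (hφ.toLp φ) k = UnitAddTorus.mFourierCoeff φ k :=
    fun k => integral_congr_ae (by
      filter_upwards [hφ.coeFn_toLp] with y hy
      rw [hy])
  have hL2 := UnitAddTorus.hasSum_mFourier_series_L2 (hφ.toLp φ)
  simp only [hcoef] at hL2
  have hsum : Summable fun k => UnitAddTorus.mFourierCoeff φ k •
      (UnitAddTorus.mFourier k : C(UnitAddTorus (Fin 3), ℂ)) := by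
    refine Summable.of_norm ?_
    simpa only [norm_smul, UnitAddTorus.mFourier_norm, mul_one] using hc
  -- Summable coefficients make the series converge uniformly. Its image in `L²` is the `L²` Fourier
  -- series, so the two sums agree almost everywhere.
  have hmap := hsum.hasSum.mapL (ContinuousMap.toLp (E := ℂ) 2
    (volume : Measure (UnitAddTorus (Fin 3))) ℂ)
  simp only [map_smul] at hmap
  have heq := hL2.unique hmap
  filter_upwards [hφ.coeFn_toLp, ContinuousMap.coeFn_toLp (𝕜 := ℂ) (p := 2)
    (volume : Measure (UnitAddTorus (Fin 3))) (∑' k, UnitAddTorus.mFourierCoeff φ k •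
      (UnitAddTorus.mFourier k : C(UnitAddTorus (Fin 3), ℂ)))] with y h1 h2
  rw [← h1, heq, h2]
  exact hsum.hasSum.mapL (ContinuousMap.evalCLM ℂ y)

theorem norm_complexify_le (f : E3 → E3) (x : E3) : ‖complexify f x‖ = ‖f x‖ := by
  rw [EuclideanSpace.norm_eq, EuclideanSpace.norm_eq]
  simp [complexify]

theorem memLp_complexify {f : E3 → E3} {μ : Measure E3} (hf : MemLp f 2 μ) :
    MemLp (complexify f) 2 μ := by
  refine hf.of_le ?_ (Eventually.of_forall fun x => (norm_complexify_le f x).le)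
  have hc : Continuous fun v : E3 => (WithLp.toLp 2 fun i => ((v i : ℝ) : ℂ) : C3) := by
    refine (PiLp.continuous_toLp 2 _).comp (continuous_pi fun i => ?_)
    exact Complex.continuous_ofReal.comp (by fun_prop)
  exact hc.comp_aestronglyMeasurable hf.1

/-- The scalar statement is applied to each coordinate on the torus and pulled back to the cube by
the projection. -/
theorem rePart_fourierSum_ae_eq {f : E3 → E3}
    (hf : MemLp f 2 ((volume : Measure E3).restrict unitCube))
    (hc : Summable fun k => (1 + sqNorm k) *
      ‖UnitAddTorus.mFourierCoeff (fun y => complexify f (torusRep y)) k‖) :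
    (fun x => rePart (fourierSum
      (UnitAddTorus.mFourierCoeff fun y => complexify f (torusRep y)) x))
      =ᵐ[(volume : Measure E3).restrict unitCube] f := by
  have := isProbabilityMeasure_torus
  set Φ : UnitAddTorus (Fin 3) → C3 := fun y => complexify f (torusRep y) with hΦ
  have hΦL : MemLp Φ 2 (volume : Measure (UnitAddTorus (Fin 3))) :=
    (memLp_complexify hf).comp_measurePreserving measurePreserving_torusRep
  have hint : ∀ k, Integrable (fun y => UnitAddTorus.mFourier (-k) y • Φ y) := fun k => by
    refine (hΦL.integrable (by norm_num)).bdd_smul 1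
      (UnitAddTorus.mFourier (-k)).continuous.aestronglyMeasurable (Eventually.of_forall fun y => ?_)
    exact ((UnitAddTorus.mFourier (-k)).norm_coe_le_norm y).trans UnitAddTorus.mFourier_norm.le
  have hcoord : ∀ i k, UnitAddTorus.mFourierCoeff (fun y => Φ y i) k
      = UnitAddTorus.mFourierCoeff Φ k i := fun i k =>
    ((EuclideanSpace.proj i : C3 →L[ℂ] ℂ).integral_comp_comm (hint k))
  have hcs : Summable fun k => ‖UnitAddTorus.mFourierCoeff Φ k‖ := by
    refine hc.of_nonneg_of_le (fun k => norm_nonneg _) fun k => ?_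
    exact le_mul_of_one_le_left (norm_nonneg _) (by linarith [sqNorm_nonneg k])
  have hae : ∀ᵐ y : UnitAddTorus (Fin 3), ∀ i,
      HasSum (fun k => UnitAddTorus.mFourierCoeff Φ k i * UnitAddTorus.mFourier k y) (Φ y i) := by
    rw [ae_all_iff]
    intro i
    have hL : MemLp (fun y => Φ y i) 2 (volume : Measure (UnitAddTorus (Fin 3))) :=
      hΦL.continuousLinearMap_comp (EuclideanSpace.proj i : C3 →L[ℂ] ℂ)
    have := ae_eq_tsum_mFourier hL (hcs.of_nonneg_of_le (fun k => norm_nonneg _) fun k => by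
      rw [hcoord]
      exact PiLp.norm_apply_le _ i)
    simpa only [hcoord] using this
  filter_upwards [measurePreserving_torusProj.quasiMeasurePreserving.ae hae,
    ae_restrict_mem measurableSet_unitCube] with x hx hxc
  have hΦx : Φ (torusProj x) = complexify f x := by rw [hΦ]; simp only [torusRep_torusProj hxc]
  rw [← rePart_complexify f x]
  congr 1
  have hs : Summable fun k => mode k (UnitAddTorus.mFourierCoeff Φ k) x := by
    refine Summable.of_norm (hcs.congr fun k => ?_)
    rw [mode, norm_smul, mul_comm Complex.I, Complex.norm_exp_ofReal_mul_I, one_mul]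
  ext i
  rw [← hΦx]
  have h1 := hs.hasSum.mapL (EuclideanSpace.proj i : C3 →L[ℂ] ℂ)
  refine h1.unique ((hx i).congr_fun fun k => ?_)
  rw [mFourier_torusProj]
  simp [mode, mul_comm]

/-- Sobolev embedding `H^s(𝕋³) ⊂ C²` for `s > 7/2`, with bounds on the function and its first
derivative. -/
theorem exists_torus_representative {s : ℝ} (hs : 7 / 2 < s) :
    ∃ C : ℝ, 0 ≤ C ∧ ∀ (f : E3 → E3) (r : ℝ), 0 ≤ r → torusSobolevNorm s f < ENNReal.ofReal r →
      ∃ F : E3 → E3, ContDiff ℝ 2 F ∧ (∀ x i, F (x + EuclideanSpace.single i 1) = F x) ∧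
        F =ᵐ[(volume : Measure E3).restrict unitCube] f ∧ (∀ x, ‖F x‖ ≤ C * r) ∧
        ∀ x, ‖fderiv ℝ F x‖ ≤ C * r := by
  obtain ⟨C₀, hC₀, hmom⟩ := summable_moments hs
  refine ⟨‖rePart‖ * ((2 * Real.pi) ^ 2 * C₀), by positivity, fun f r hr hf => ?_⟩
  rw [torusSobolevNorm, iInf_lt_iff] at hf
  obtain ⟨h, hf⟩ := hf
  obtain ⟨h1, h2⟩ := hmom _ r hr hf
  obtain ⟨hcd, hb0, hb1⟩ := fourierSum_properties h1 h2
  refine ⟨_, rePart.contDiff.comp hcd, fun x i => ?_, rePart_fourierSum_ae_eq h h1, fun x => ?_,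
    fun x => ?_⟩
  · simp only [Function.comp, fourierSum, mode_add_single]
  · refine (rePart.le_opNorm_of_le (hb0 x)).trans (le_of_eq (by ring))
  · have hd := rePart.hasFDerivAt.comp x
      ((hcd.differentiable (by norm_num)).differentiableAt (x := x)).hasFDerivAt
    rw [hd.fderiv]
    refine (ContinuousLinearMap.opNorm_comp_le _ _).trans ?_
    calc _ ≤ ‖rePart‖ * ((2 * Real.pi) ^ 2 * (C₀ * r)) := by
          gcongr
          exact hb1 x
      _ = _ := by ring

end TorusSobolev

end EulerFlow

namespace EulerFlow

/-! ### Continuous representatives on the three kinds of domain -/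

section Representatives

theorem FluidDomain.isOpen_carrier (D : FluidDomain) : IsOpen D.carrier := by
  cases D with
  | space => exact isOpen_univ
  | torus => exact isOpen_univ
  | bounded Ω hΩ => exact hΩ.isOpen

/-- The measure of a fluid domain, supported on a fundamental domain in the case of the torus. -/
noncomputable def FluidDomain.measure : FluidDomain → Measure E3
  | .space => volume
  | .torus => (volume : Measure E3).restrict unitCube
  | .bounded Ω _ => (volume : Measure E3).restrict Ω

/-- Sobolev embedding on a fluid domain. -/
theorem FluidDomain.exists_representative (D : FluidDomain) {s : ℝ} (hs : 7 / 2 < s) :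
    ∃ C : ℝ, 0 ≤ C ∧ ∀ (f : E3 → E3) (r : ℝ), 0 ≤ r → D.sobolevNorm s f < ENNReal.ofReal r →
      ∃ F : E3 → E3, ContDiff ℝ 2 F ∧ D.IsFunction F ∧ F =ᵐ[D.measure] f ∧ (∀ x, ‖F x‖ ≤ C * r) ∧
        ∀ x, ‖fderiv ℝ F x‖ ≤ C * r := by
  cases D with
  | space =>
    obtain ⟨C, hC, h⟩ := exists_space_representative hs
    refine ⟨C, hC, fun f r hr hf => ?_⟩
    obtain ⟨F, h1, h2, h3⟩ := h f r hr hf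
    exact ⟨F, h1, trivial, h2, h3⟩
  | torus =>
    obtain ⟨C, hC, h⟩ := exists_torus_representative hs
    exact ⟨C, hC, h⟩
  | bounded Ω hΩ =>
    obtain ⟨C, hC, h⟩ := exists_space_representative hs
    refine ⟨C, hC, fun f r hr hf => ?_⟩
    simp only [FluidDomain.sobolevNorm, domainSobolevNorm, iInf_lt_iff] at hf
    obtain ⟨g, hg, hf⟩ := hf
    obtain ⟨F, h1, h2, h3⟩ := h g r hr hf
    exact ⟨F, h1, trivial, EventuallyEq.trans (ae_restrict_of_ae h2) hg, h3⟩

theorem convex_unitCube : Convex ℝ unitCube := by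
  intro x hx y hy a b ha hb hab i
  exact (convex_Ico (0 : ℝ) 1) (hx i) (hy i) ha hb hab

/-- The half-open cube is not open; this is the property that lets almost everywhere equality of
continuous functions become equality on it. -/
theorem unitCube_subset_closure_interior : unitCube ⊆ closure (interior unitCube) := by
  have hne : (interior unitCube).Nonempty := by
    refine ⟨WithLp.toLp 2 fun _ => 1 / 2, ?_⟩
    rw [mem_interior]
    refine ⟨⋂ i, (fun x : E3 => x i) ⁻¹' Ioo 0 1, fun x hx i => ?_,
      isOpen_iInter_of_finite fun i => isOpen_Ioo.preimage (by fun_prop), ?_⟩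
    · exact Ioo_subset_Ico_self (mem_iInter.1 hx i)
    · simp only [mem_iInter, mem_preimage, mem_Ioo]
      norm_num
  rw [convex_unitCube.closure_interior_eq_closure_of_nonempty_interior hne]
  exact subset_closure

theorem exists_unitCube_translate (x : E3) : ∃ y ∈ unitCube, ∀ {α : Type} (f : E3 → α),
    (∀ x (i : Fin 3), f (x + EuclideanSpace.single i 1) = f x) → f x = f y := by
  refine ⟨x - ⌊x 0⌋ • EuclideanSpace.single 0 (1 : ℝ) - ⌊x 1⌋ • EuclideanSpace.single 1 (1 : ℝ)
    - ⌊x 2⌋ • EuclideanSpace.single 2 (1 : ℝ), fun i => ?_, fun f hf => ?_⟩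
  · fin_cases i <;> simp [Int.fract_lt_one]
  · have hp : ∀ i, Function.Periodic f (EuclideanSpace.single i (1 : ℝ)) := fun i x => hf x i
    rw [(hp 2).sub_zsmul_eq, (hp 1).sub_zsmul_eq, (hp 0).sub_zsmul_eq]

/-- Nonempty open sets have positive measure. On the torus the measure sees only the unit cube, and
periodicity does the rest. -/
theorem FluidDomain.eqOn_carrier_of_ae_eq (D : FluidDomain) {F G : E3 → E3}
    (hF : ContinuousOn F D.carrier) (hG : ContinuousOn G D.carrier) (hF' : D.IsFunction F)
    (hG' : D.IsFunction G) (h : F =ᵐ[D.measure] G) : EqOn F G D.carrier := by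
  cases D with
  | space =>
    exact Measure.eqOn_open_of_ae_eq (μ := volume) (ae_restrict_of_ae h) isOpen_univ hF hG
  | torus =>
    have hcube : EqOn F G unitCube := Measure.eqOn_of_ae_eq h (hF.mono (subset_univ _))
      (hG.mono (subset_univ _)) unitCube_subset_closure_interior
    intro x _
    obtain ⟨y, hy, hxy⟩ := exists_unitCube_translate x
    rw [hxy F hF', hxy G hG', hcube hy]
  | bounded Ω hΩ => exact Measure.eqOn_open_of_ae_eq h hΩ.isOpen hF hG

theorem FluidDomain.IsFunction.sub {D : FluidDomain} {f g : E3 → E3} (hf : D.IsFunction f)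
    (hg : D.IsFunction g) : D.IsFunction (f - g) := by
  cases D with
  | space => trivial
  | torus => exact fun x i => by rw [Pi.sub_apply, Pi.sub_apply, hf, hg]
  | bounded Ω hΩ => trivial

theorem FluidDomain.IsFunction.const_smul {D : FluidDomain} {f : E3 → E3} (hf : D.IsFunction f)
    (c : ℝ) : D.IsFunction (c • f) := by
  cases D with
  | space => trivial
  | torus => exact fun x i => by rw [Pi.smul_apply, Pi.smul_apply, hf]
  | bounded Ω hΩ => trivial

/-- On `Ω`, the function `f` agrees with a global `C²` function which is bounded by `B` together
with its first derivative. -/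
def HasC2Bound (Ω : Set E3) (B : ℝ) (f : E3 → E3) : Prop :=
  ∃ F : E3 → E3, ContDiff ℝ 2 F ∧ EqOn f F Ω ∧ (∀ x, ‖F x‖ ≤ B) ∧ ∀ x, ‖fderiv ℝ F x‖ ≤ B

theorem HasC2Bound.mono {Ω : Set E3} {B B' : ℝ} {f : E3 → E3} (h : HasC2Bound Ω B f)
    (hB : B ≤ B') : HasC2Bound Ω B' f := by
  obtain ⟨F, h1, h2, h3, h4⟩ := h
  exact ⟨F, h1, h2, fun x => (h3 x).trans hB, fun x => (h4 x).trans hB⟩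

theorem FluidDomain.exists_hasC2Bound (D : FluidDomain) {s : ℝ} (hs : 7 / 2 < s) :
    ∃ C : ℝ, 0 < C ∧ ∀ (f g : E3 → E3) (r : ℝ), 0 ≤ r → D.sobolevNorm s f < ENNReal.ofReal r →
      g =ᵐ[D.measure] f → ContinuousOn g D.carrier → D.IsFunction g →
      HasC2Bound D.carrier (C * r) g := by
  obtain ⟨C, hC, h⟩ := D.exists_representative hs
  -- The `+ 1` makes the constant positive, so that it can later be divided by.
  refine ⟨C + 1, by linarith, fun f g r hr hf hgf hgc hg => ?_⟩
  obtain ⟨F, h1, h2, h3, h4, h5⟩ := h f r hr hf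
  refine HasC2Bound.mono (B := C * r) ⟨F, h1, ?_, h4, h5⟩ (by nlinarith)
  exact D.eqOn_carrier_of_ae_eq hgc h1.continuous.continuousOn hg h2 (hgf.trans h3.symm)

end Representatives

/-! ### Classical regularity of the velocity in space and time -/

section Regularity

/-- A time-dependent velocity field which is `C¹` in time with values in the `C²` functions with the
topology of `C¹`, with time derivative `W`. -/
structure IsRegularVelocity (Ω : Set E3) (I : Set ℝ) (u W : ℝ → E3 → E3) : Prop where
  bound : ∀ t ∈ I, ∃ B, HasC2Bound Ω B (u t)
  small : ∀ t ∈ I, ∀ ε > 0, ∀ᶠ τ in 𝓝[I] t, HasC2Bound Ω ε (u τ - u t)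
  bound_deriv : ∀ t ∈ I, ∃ B, HasC2Bound Ω B (W t)
  small_deriv : ∀ t ∈ I, ∀ ε > 0, ∀ᶠ τ in 𝓝[I] t, HasC2Bound Ω ε (W τ - W t)
  deriv : ∀ t ∈ I, ∀ ε > 0, ∀ᶠ τ in 𝓝[I \ {t}] t,
    HasC2Bound Ω ε ((τ - t)⁻¹ • (u τ - u t) - W t)

theorem exists_lt_ofReal {a : ℝ≥0∞} (ha : a < ⊤) : ∃ r : ℝ, 0 ≤ r ∧ a < ENNReal.ofReal r := by
  refine ⟨a.toReal + 1, by positivity, ?_⟩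
  rw [ENNReal.lt_ofReal_iff_toReal_lt ha.ne]
  linarith

/-- Since `s - 1 > 7/2`, convergence in `H^{s-1}` controls functions and first derivatives
uniformly. The time derivative is known only up to null sets, so `W` is chosen among its `C²`
representatives. -/
theorem IsEulerSolution.exists_isRegularVelocity {D : FluidDomain} {s : ℝ} (hs : 9 / 2 < s)
    {Tstar : EReal} {u : ℝ → E3 → E3} (hu : IsEulerSolution D s Tstar u) :
    ∃ W, IsRegularVelocity D.carrier (timeInterval Tstar) u W := by
  obtain ⟨h0, w, hw, hder⟩ := hu.isC1
  obtain ⟨C, hC, hrep⟩ := D.exists_representative (s := s - 1) (by linarith)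
  obtain ⟨K, hK, hbd⟩ := D.exists_hasC2Bound (s := s - 1) (by linarith)
  have huc : ∀ t ∈ timeInterval Tstar, ContinuousOn (u t) D.carrier := fun t ht =>
    (hu.continuousOn t ht).mono subset_closure
  have hW : ∀ t, ∃ W : E3 → E3, t ∈ timeInterval Tstar →
      ContDiff ℝ 2 W ∧ D.IsFunction W ∧ W =ᵐ[D.measure] w t := by
    intro t
    by_cases ht : t ∈ timeInterval Tstar
    · obtain ⟨r, hr, hlt⟩ := exists_lt_ofReal (hw t ht).1
      obtain ⟨F, h1, h2, h3, -⟩ := hrep _ r hr hlt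
      exact ⟨F, fun _ => ⟨h1, h2, h3⟩⟩
    · exact ⟨0, fun h => absurd h ht⟩
  choose W hW using hW
  have hsm : ∀ ε > 0, 0 < ENNReal.ofReal (ε / K) := fun ε hε => ENNReal.ofReal_pos.2 (by positivity)
  have hKε : ∀ ε : ℝ, K * (ε / K) = ε := fun ε => mul_div_cancel₀ ε hK.ne'
  refine ⟨W, ⟨fun t ht => ?_, fun t ht ε hε => ?_, fun t ht => ?_, fun t ht ε hε => ?_,
    fun t ht ε hε => ?_⟩⟩
  · obtain ⟨r, hr, hlt⟩ := exists_lt_ofReal (h0 t ht).1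
    exact ⟨_, hbd _ _ r hr hlt EventuallyEq.rfl (huc t ht) (hu.isFunction t ht)⟩
  · filter_upwards [(h0 t ht).2.eventually_lt_const (hsm ε hε), self_mem_nhdsWithin] with τ hlt hτ
    rw [← hKε ε]
    exact hbd _ _ _ (by positivity) hlt EventuallyEq.rfl ((huc τ hτ).sub (huc t ht))
      ((hu.isFunction τ hτ).sub (hu.isFunction t ht))
  · obtain ⟨r, hr, hlt⟩ := exists_lt_ofReal (hw t ht).1
    exact ⟨_, hbd _ _ r hr hlt (hW t ht).2.2 (hW t ht).1.continuous.continuousOn (hW t ht).2.1⟩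
  · filter_upwards [(hw t ht).2.eventually_lt_const (hsm ε hε), self_mem_nhdsWithin] with τ hlt hτ
    rw [← hKε ε]
    exact hbd _ _ _ (by positivity) hlt ((hW τ hτ).2.2.sub (hW t ht).2.2)
      ((hW τ hτ).1.sub (hW t ht).1).continuous.continuousOn ((hW τ hτ).2.1.sub (hW t ht).2.1)
  · filter_upwards [(hder t ht).eventually_lt_const (hsm ε hε), self_mem_nhdsWithin] with τ hlt hτ
    rw [← hKε ε]
    exact hbd _ _ _ (by positivity) hlt (EventuallyEq.rfl.sub (hW t ht).2.2)
      ((((huc τ hτ.1).sub (huc t ht)).const_smul _).sub (hW t ht).1.continuous.continuousOn)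
      ((((hu.isFunction τ hτ.1).sub (hu.isFunction t ht)).const_smul _).sub (hW t ht).2.1)

/-- A locally uniform bound on a compact interval is uniform. -/
theorem exists_uniform_bound {T : ℝ} {Q : ℝ → ℝ → Prop} (hmono : ∀ t a b, a ≤ b → Q t a → Q t b)
    (hloc : ∀ t ∈ Icc 0 T, ∃ M, ∀ᶠ τ in 𝓝[Icc 0 T] t, Q τ M) : ∃ M, ∀ t ∈ Icc 0 T, Q t M := by
  refine isCompact_Icc.induction_on (p := fun S => ∃ M, ∀ t ∈ S, Q t M) ⟨0, by simp⟩
    (fun S S' hS ⟨M, hM⟩ => ⟨M, fun t ht => hM t (hS ht)⟩) ?_ ?_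
  · rintro S S' ⟨M, hM⟩ ⟨M', hM'⟩
    refine ⟨max M M', fun t ht => ?_⟩
    rcases ht with ht | ht
    · exact hmono _ _ _ (le_max_left _ _) (hM t ht)
    · exact hmono _ _ _ (le_max_right _ _) (hM' t ht)
  · intro t ht
    obtain ⟨M, hM⟩ := hloc t ht
    exact ⟨_, hM, M, fun _ h => h⟩

theorem HasC2Bound.norm_le {Ω : Set E3} {B : ℝ} {f : E3 → E3} (h : HasC2Bound Ω B f) {x : E3}
    (hx : x ∈ Ω) : ‖f x‖ ≤ B := by
  obtain ⟨F, -, h2, h3, -⟩ := h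
  rw [h2 hx]
  exact h3 x

theorem HasC2Bound.norm_sub_le {Ω : Set E3} {B : ℝ} {f : E3 → E3} (h : HasC2Bound Ω B f)
    {x y : E3} (hx : x ∈ Ω) (hy : y ∈ Ω) : ‖f x - f y‖ ≤ B * ‖x - y‖ := by
  obtain ⟨F, h1, h2, -, h4⟩ := h
  rw [h2 hx, h2 hy]
  exact convex_univ.norm_image_sub_le_of_norm_fderiv_le
    (fun x _ => (h1.differentiable (by norm_num)).differentiableAt) (fun x _ => h4 x)
    (mem_univ _) (mem_univ _)

theorem HasC2Bound.contDiffAt {Ω : Set E3} {B : ℝ} {f : E3 → E3} (h : HasC2Bound Ω B f)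
    (hΩ : IsOpen Ω) {x : E3} (hx : x ∈ Ω) : ContDiffAt ℝ 2 f x := by
  obtain ⟨F, h1, h2, -, -⟩ := h
  exact h1.contDiffAt.congr_of_eventuallyEq (h2.eventuallyEq_of_mem (hΩ.mem_nhds hx))

theorem HasC2Bound.norm_fderiv_le {Ω : Set E3} {B : ℝ} {f : E3 → E3} (h : HasC2Bound Ω B f)
    (hΩ : IsOpen Ω) {x : E3} (hx : x ∈ Ω) : ‖fderiv ℝ f x‖ ≤ B := by
  obtain ⟨F, -, h2, -, h4⟩ := h
  rw [(h2.eventuallyEq_of_mem (hΩ.mem_nhds hx)).fderiv_eq]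
  exact h4 x

namespace IsRegularVelocity

variable {Ω : Set E3} {I : Set ℝ} {u W : ℝ → E3 → E3}

theorem contDiffAt (h : IsRegularVelocity Ω I u W) (hΩ : IsOpen Ω) {t : ℝ} (ht : t ∈ I) {x : E3}
    (hx : x ∈ Ω) : ContDiffAt ℝ 2 (u t) x := by
  obtain ⟨B, hB⟩ := h.bound t ht
  exact hB.contDiffAt hΩ hx

theorem contDiffAt_deriv (h : IsRegularVelocity Ω I u W) (hΩ : IsOpen Ω) {t : ℝ} (ht : t ∈ I)
    {x : E3} (hx : x ∈ Ω) : ContDiffAt ℝ 2 (W t) x := by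
  obtain ⟨B, hB⟩ := h.bound_deriv t ht
  exact hB.contDiffAt hΩ hx

theorem hasDerivWithinAt (h : IsRegularVelocity Ω I u W) {t : ℝ} (ht : t ∈ I) {x : E3}
    (hx : x ∈ Ω) : HasDerivWithinAt (fun τ => u τ x) (W t x) I t := by
  rw [hasDerivWithinAt_iff_tendsto_slope, Metric.tendsto_nhds]
  intro ε hε
  filter_upwards [h.deriv t ht (ε / 2) (by positivity)] with τ hτ
  have := hτ.norm_le hx
  rw [dist_eq_norm]
  calc _ ≤ ε / 2 := by simpa [slope] using this
    _ < ε := by linarith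

/-- The velocity is jointly Lipschitz up to the boundary. -/
theorem exists_lipschitz (h : IsRegularVelocity Ω I u W) {T : ℝ} (hI : Icc 0 T ⊆ I)
    (hc : ∀ t ∈ I, ContinuousOn (u t) (closure Ω)) :
    ∃ K : NNReal, LipschitzOnWith K (fun p : ℝ × E3 => u p.1 p.2) (Icc 0 T ×ˢ closure Ω) := by
  obtain ⟨L, hL⟩ := exists_uniform_bound (T := T)
    (Q := fun t L => ∀ x ∈ Ω, ∀ y ∈ Ω, ‖u t x - u t y‖ ≤ L * ‖x - y‖)
    (fun t a b hab hQ x hx y hy => (hQ x hx y hy).trans (by gcongr)) (fun t ht => by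
      obtain ⟨B, hB⟩ := h.bound t (hI ht)
      -- At nearby times the velocity differs by a field of Lipschitz constant at most `1`;
      -- compactness of `[0,T]` then gives a uniform constant.
      refine ⟨B + 1, ?_⟩
      filter_upwards [nhdsWithin_mono t hI (h.small t (hI ht) 1 one_pos)] with τ hτ x hx y hy
      have h1 := hB.norm_sub_le hx hy
      have h2 := hτ.norm_sub_le hx hy
      have h3 : u τ x - u τ y = (u t x - u t y) + ((u τ - u t) x - (u τ - u t) y) := by
        simp only [Pi.sub_apply]
        abel
      rw [h3]
      exact (norm_add_le _ _).trans (by linarith))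
  obtain ⟨M, hM⟩ := exists_uniform_bound (T := T)
    (Q := fun t M => ∀ x ∈ Ω, ‖W t x‖ ≤ M)
    (fun t a b hab hQ x hx => (hQ x hx).trans hab) (fun t ht => by
      obtain ⟨B, hB⟩ := h.bound_deriv t (hI ht)
      refine ⟨B + 1, ?_⟩
      filter_upwards [nhdsWithin_mono t hI (h.small_deriv t (hI ht) 1 one_pos)] with τ hτ x hx
      have h1 := hB.norm_le hx
      have h2 := hτ.norm_le hx
      have h3 : W τ x = W t x + (W τ - W t) x := by simp
      rw [h3]
      exact (norm_add_le _ _).trans (by linarith))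
  have hL' : ∀ t ∈ Icc 0 T, LipschitzOnWith (Real.toNNReal L) (u t) (closure Ω) := by
    intro t ht
    refine LipschitzOnWith.closure (hc t (hI ht)) (LipschitzOnWith.of_dist_le_mul ?_)
    intro x hx y hy
    rw [dist_eq_norm, dist_eq_norm]
    exact (hL t ht x hx y hy).trans (by gcongr; exact Real.le_coe_toNNReal L)
  have hM' : ∀ x ∈ closure Ω, ∀ t ∈ Icc 0 T, ∀ τ ∈ Icc 0 T,
      ‖u τ x - u t x‖ ≤ M * ‖τ - t‖ := by
    intro x hx t ht τ hτ
    have hcont : ContinuousOn (fun x => ‖u τ x - u t x‖) (closure Ω) :=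
      ((hc τ (hI hτ)).sub (hc t (hI ht))).norm
    -- The time derivative `W` is bounded only on the open domain; the resulting estimate passes to
    -- the closure by continuity of `u`.
    refine le_on_closure (fun x hx => ?_) hcont continuousOn_const hx
    exact (convex_Icc 0 T).norm_image_sub_le_of_norm_hasDerivWithin_le
      (f := fun τ => u τ x) (f' := fun τ => W τ x)
      (fun t ht => (h.hasDerivWithinAt (hI ht) hx).mono hI) (fun t ht => hM t ht x hx) ht hτ
  refine ⟨Real.toNNReal M + Real.toNNReal L, LipschitzOnWith.of_dist_le_mul ?_⟩
  rintro ⟨τ, x⟩ ⟨hτ, hx⟩ ⟨t, y⟩ ⟨ht, hy⟩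
  simp only at hτ hx ht hy ⊢
  have h1 : dist (u τ x) (u t x) ≤ Real.toNNReal M * dist (τ, x) (t, y) := by
    rw [dist_eq_norm]
    refine (hM' x hx t ht τ hτ).trans ?_
    have : ‖τ - t‖ ≤ dist (τ, x) (t, y) := by
      rw [Prod.dist_eq, ← dist_eq_norm]
      exact le_max_left _ _
    exact mul_le_mul (Real.le_coe_toNNReal M) this (norm_nonneg _) NNReal.zero_le_coe
  have h2 : dist (u t x) (u t y) ≤ Real.toNNReal L * dist (τ, x) (t, y) := by
    refine ((hL' t ht).dist_le_mul x hx y hy).trans ?_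
    gcongr
    rw [Prod.dist_eq]
    exact le_max_right _ _
  push_cast
  rw [add_mul]
  exact (dist_triangle _ _ _).trans (add_le_add h1 h2)

/-- The velocity gradient is continuous along continuous curves. -/
theorem continuousOn_fderiv (h : IsRegularVelocity Ω I u W) (hΩ : IsOpen Ω) {J : Set ℝ}
    (hJ : J ⊆ I) {γ : ℝ → E3} (hγ : ContinuousOn γ J) (hmem : ∀ t ∈ J, γ t ∈ Ω) :
    ContinuousOn (fun t => fderiv ℝ (u t) (γ t)) J := by
  intro t ht
  have hcd : ContinuousAt (fderiv ℝ (u t)) (γ t) :=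
    (h.contDiffAt hΩ (hJ ht) (hmem t ht)).continuousAt_fderiv (by norm_num)
  have hcomp : ContinuousWithinAt (fun τ => fderiv ℝ (u t) (γ τ)) J t :=
    hcd.comp_continuousWithinAt (hγ t ht)
  -- The increment is split into a change of time at the fixed point `γ τ`, small uniformly in
  -- space, and a change of point for the fixed field `u t`.
  have hsmall : Tendsto (fun τ => fderiv ℝ (u τ) (γ τ) - fderiv ℝ (u t) (γ τ)) (𝓝[J] t) (𝓝 0) := by
    rw [Metric.tendsto_nhds]
    intro ε hε
    filter_upwards [nhdsWithin_mono t hJ (h.small t (hJ ht) (ε / 2) (by positivity)),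
      self_mem_nhdsWithin] with τ hτ hτJ
    have h1 := hτ.norm_fderiv_le hΩ (hmem τ hτJ)
    rw [fderiv_sub ((h.contDiffAt hΩ (hJ hτJ) (hmem τ hτJ)).differentiableAt (by norm_num))
      ((h.contDiffAt hΩ (hJ ht) (hmem τ hτJ)).differentiableAt (by norm_num))] at h1
    rw [dist_zero_right]
    linarith
  have := hsmall.add hcomp
  simpa [ContinuousWithinAt] using this

/-- The material derivative of the velocity gradient. -/
theorem hasDerivWithinAt_fderiv (h : IsRegularVelocity Ω I u W) (hΩ : IsOpen Ω) {J : Set ℝ}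
    (hJ : J ⊆ I) {γ : ℝ → E3} (hmem : ∀ t ∈ J, γ t ∈ Ω) {t : ℝ} (ht : t ∈ J) {v : E3}
    (hγ : HasDerivWithinAt γ v J t) :
    HasDerivWithinAt (fun τ => fderiv ℝ (u τ) (γ τ))
      (fderiv ℝ (W t) (γ t) + fderiv ℝ (fderiv ℝ (u t)) (γ t) v) J t := by
  have hdiff : DifferentiableAt ℝ (fderiv ℝ (u t)) (γ t) :=
    ((h.contDiffAt hΩ (hJ ht) (hmem t ht)).fderiv_right (m := 1) (by norm_num)).differentiableAt
      (by norm_num)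
  have hspace : HasDerivWithinAt (fun τ => fderiv ℝ (u t) (γ τ))
      (fderiv ℝ (fderiv ℝ (u t)) (γ t) v) J t := hdiff.hasFDerivAt.comp_hasDerivWithinAt t hγ
  have htime : HasDerivWithinAt (fun τ => fderiv ℝ (u τ) (γ τ) - fderiv ℝ (u t) (γ τ))
      (fderiv ℝ (W t) (γ t)) J t := by
    rw [hasDerivWithinAt_iff_tendsto_slope]
    have hWc : Tendsto (fun τ => fderiv ℝ (W t) (γ τ)) (𝓝[J \ {t}] t)
        (𝓝 (fderiv ℝ (W t) (γ t))) :=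
      (((h.contDiffAt_deriv hΩ (hJ ht) (hmem t ht)).continuousAt_fderiv
        (by norm_num)).comp_continuousWithinAt hγ.continuousWithinAt).mono_left
        (nhdsWithin_mono t sdiff_subset)
    -- The difference quotient is compared with the gradient of `W t` at the moving point `γ τ`,
    -- where the uniform estimate applies; continuity of that gradient then replaces `γ τ` by `γ t`.
    have hsmall : Tendsto (fun τ => (τ - t)⁻¹ • (fderiv ℝ (u τ) (γ τ) - fderiv ℝ (u t) (γ τ))
        - fderiv ℝ (W t) (γ τ)) (𝓝[J \ {t}] t) (𝓝 0) := by
      rw [Metric.tendsto_nhds]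
      intro ε hε
      filter_upwards [nhdsWithin_mono t (sdiff_subset_sdiff_left hJ)
        (h.deriv t (hJ ht) (ε / 2) (by positivity)), self_mem_nhdsWithin] with τ hτ hτJ
      have h1 := hτ.norm_fderiv_le hΩ (hmem τ hτJ.1)
      have du := (h.contDiffAt hΩ (hJ hτJ.1) (hmem τ hτJ.1)).differentiableAt (by norm_num)
      have dt := (h.contDiffAt hΩ (hJ ht) (hmem τ hτJ.1)).differentiableAt (by norm_num)
      have dW := (h.contDiffAt_deriv hΩ (hJ ht) (hmem τ hτJ.1)).differentiableAt (by norm_num)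
      rw [fderiv_sub ((du.sub dt).const_smul _) dW, fderiv_const_smul (du.sub dt),
        fderiv_sub du dt] at h1
      rw [dist_zero_right]
      linarith
    have := hsmall.add hWc
    rw [zero_add] at this
    refine this.congr fun τ => ?_
    simp [slope]
  have := htime.add hspace
  refine this.congr (fun τ _ => ?_) ?_ <;> simp

end IsRegularVelocity

end Regularity

end EulerFlow

namespace EulerFlow

/-! ### Tangential vector fields near the boundary -/

section Boundary

theorem inner_gradient_eq_fderiv (ρ : E3 → ℝ) (x v : E3) :
    inner ℝ (gradient ρ x) v = fderiv ℝ ρ x v := by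
  rw [gradient, InnerProductSpace.toDual_symm_apply]

/-- Near a boundary point, a tangential Lipschitz vector field changes the defining function at a
rate controlled by the defining function itself. -/
theorem IsDefiningFunctionAt.exists_tangential_bound {Ω : Set E3} (hΩ : IsOpen Ω) {p : E3}
    {ρ : E3 → ℝ} (hρ : IsDefiningFunctionAt Ω p ρ) {K M : ℝ} (hK : 0 ≤ K) (hM : 0 ≤ M) :
    ∃ C : ℝ, ∀ᶠ y in 𝓝 p, y ∈ Ω → ∀ v : E3 → E3,
      (∀ x ∈ closure Ω, ∀ y ∈ closure Ω, ‖v x - v y‖ ≤ K * ‖x - y‖) → ‖v y‖ ≤ M →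
      (∀ q ∈ frontier Ω, ∀ n : E3, IsOutwardUnitNormal Ω q n → inner ℝ (v q) n = 0) →
      |fderiv ℝ ρ y (v y)| ≤ C * |ρ y| := by
  set e : E3 := gradient ρ p with he
  have hepos : 0 < ‖e‖ := norm_pos_iff.2 hρ.regular
  -- The derivative of `ρ` along `e` equals `|e|²` at `p`, hence exceeds half of it nearby. Moving
  -- from `y` along `e` thus reaches `ρ = 0` after a parameter of at most `|ρ y| / c`.
  set c : ℝ := ‖e‖ ^ 2 / 2 with hc
  have hcpos : 0 < c := by positivity
  have hsm : ContDiff ℝ 2 ρ := contDiff_infty.1 hρ.smooth 2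
  have hd : Differentiable ℝ ρ := hsm.differentiable (by norm_num)
  have hfd : ContDiff ℝ 1 (fderiv ℝ ρ) := hsm.fderiv_right (by norm_num)
  have hdir : ∀ᶠ z in 𝓝 p, c < fderiv ℝ ρ z e := by
    have hcont : Continuous fun z => fderiv ℝ ρ z e := hfd.continuous.clm_apply continuous_const
    refine hcont.continuousAt.eventually_const_lt ?_
    change c < fderiv ℝ ρ p e
    rw [← inner_gradient_eq_fderiv, ← he, real_inner_self_eq_norm_sq]
    linarith
  have hnorm : ∀ᶠ z in 𝓝 p, ‖fderiv ℝ ρ z‖ < ‖fderiv ℝ ρ p‖ + 1 :=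
    hfd.continuous.norm.continuousAt.eventually_lt_const (by linarith)
  obtain ⟨L, S, hS, hL⟩ := hfd.contDiffAt.exists_lipschitzOnWith (x := p)
  obtain ⟨r, hr, hball⟩ := Metric.eventually_nhds_iff_ball.1
    ((hdir.and hnorm).and ((eventually_mem_set.2 hS).and hρ.mem_iff))
  refine ⟨(L * M + (‖fderiv ℝ ρ p‖ + 1) * K) * (‖e‖ / c), ?_⟩
  -- This keeps the segment from `y` to the boundary inside the ball on which all estimates hold.
  have hclose : ∀ᶠ y in 𝓝 p, |ρ y| / c * ‖e‖ < r / 2 := by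
    have hcont : Continuous fun y => |ρ y| / c * ‖e‖ :=
      (hsm.continuous.abs.div_const c).mul continuous_const
    refine hcont.continuousAt.eventually_lt_const ?_
    change |ρ p| / c * ‖e‖ < r / 2
    rw [hρ.zero]
    simpa using hr
  filter_upwards [hclose, Metric.ball_mem_nhds p (half_pos hr)] with y hy1 hy2 hyΩ v hvK hvM hvn
  have hyball : y ∈ Metric.ball p r := Metric.ball_subset_ball (by linarith) hy2
  have hρy : ρ y < 0 := (hball y hyball).2.2.1 hyΩ
  set s₁ : ℝ := |ρ y| / c with hs₁
  have hs₁0 : 0 ≤ s₁ := by positivity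
  have hseg : ∀ s ∈ Icc 0 s₁, y + s • e ∈ Metric.ball p r := by
    intro s hs
    rw [Metric.mem_ball, dist_eq_norm] at hy2 ⊢
    have h1 : ‖s • e‖ ≤ s₁ * ‖e‖ := by
      rw [norm_smul, Real.norm_eq_abs, abs_of_nonneg hs.1]
      gcongr
      exact hs.2
    calc ‖y + s • e - p‖ = ‖(y - p) + s • e‖ := by congr 1; abel
      _ ≤ ‖y - p‖ + ‖s • e‖ := norm_add_le _ _
      _ < r := by linarith
  set φ : ℝ → ℝ := fun s => ρ (y + s • e) with hφ
  have hφd : ∀ s, HasDerivAt φ (fderiv ℝ ρ (y + s • e) e) s := by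
    intro s
    have h1 : HasDerivAt (fun s : ℝ => y + s • e) e s := by
      simpa using ((hasDerivAt_id s).smul_const e).const_add y
    exact (hd (y + s • e)).hasFDerivAt.comp_hasDerivAt s h1
  have hφc : Continuous φ := continuous_iff_continuousAt.2 fun s => (hφd s).continuousAt
  have hmono : ∀ a ∈ Icc 0 s₁, ∀ b ∈ Icc 0 s₁, a ≤ b → c * (b - a) ≤ φ b - φ a :=
    (convex_Icc 0 s₁).mul_sub_le_image_sub_of_le_deriv hφc.continuousOn
      (fun s _ => (hφd s).differentiableAt.differentiableWithinAt) (fun s hs => by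
        rw [(hφd s).deriv]
        exact (hball _ (hseg s (interior_subset hs))).1.1.le)
  have hφ0 : φ 0 = ρ y := by simp [hφ]
  have hφ1 : 0 ≤ φ s₁ := by
    have := hmono 0 ⟨le_rfl, hs₁0⟩ s₁ ⟨hs₁0, le_rfl⟩ hs₁0
    have hcs : c * s₁ = -ρ y := by rw [hs₁, mul_div_cancel₀ _ hcpos.ne', abs_of_neg hρy]
    rw [sub_zero, hφ0] at this
    linarith
  obtain ⟨s, hs, hφs⟩ := intermediate_value_Icc hs₁0 hφc.continuousOn
    (show (0 : ℝ) ∈ Icc (φ 0) (φ s₁) from ⟨by rw [hφ0]; exact hρy.le, hφ1⟩)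
  have hspos : 0 < s := by
    refine lt_of_le_of_ne hs.1 fun h => ?_
    rw [← h, hφ0] at hφs
    linarith
  set z : E3 := y + s • e with hz
  have hzball : z ∈ Metric.ball p r := hseg s hs
  -- Since `ρ` strictly increases along the segment, it is negative before `z`, so the earlier
  -- points lie in `Ω`.
  have hzcl : z ∈ closure Ω := by
    have hlim : Tendsto (fun a : ℝ => y + a • e) (𝓝[<] s) (𝓝 z) := by
      have : Continuous fun a : ℝ => y + a • e := by fun_prop
      exact this.continuousAt.mono_left nhdsWithin_le_nhds
    refine mem_closure_of_tendsto hlim ?_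
    filter_upwards [Ioo_mem_nhdsLT hspos] with a ha
    have ha' : a ∈ Icc 0 s₁ := ⟨ha.1.le, ha.2.le.trans hs.2⟩
    refine (hball _ (hseg a ha')).2.2.2 ?_
    have h1 := hmono a ha' s hs ha.2.le
    have h2 : 0 < c * (s - a) := mul_pos hcpos (by linarith [ha.2])
    change φ a < 0
    linarith
  have hzfr : z ∈ frontier Ω := by
    rw [hΩ.frontier_eq]
    refine ⟨hzcl, fun h => ?_⟩
    have := (hball z hzball).2.2.1 h
    exact absurd hφs this.ne
  have hzdef : IsDefiningFunctionAt Ω z ρ := by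
    refine ⟨hρ.smooth, hφs, fun h => ?_, ?_⟩
    · have h1 := (hball z hzball).1.1
      rw [← inner_gradient_eq_fderiv, h, inner_zero_left] at h1
      linarith
    · filter_upwards [Metric.isOpen_ball.mem_nhds hzball] with x hx
      exact (hball x hx).2.2
  -- The same `ρ` is a defining function at `z`, so its gradient there is normal and tangency
  -- applies.
  have htan : fderiv ℝ ρ z (v z) = 0 := by
    have h1 := hvn z hzfr _ ⟨ρ, hzdef, rfl⟩
    rw [inner_smul_right, real_inner_comm, inner_gradient_eq_fderiv] at h1
    exact (mul_eq_zero.1 h1).resolve_left (inv_ne_zero (norm_ne_zero_iff.2 hzdef.regular))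
  have hyz : ‖y - z‖ ≤ |ρ y| * (‖e‖ / c) := by
    have : y - z = -(s • e) := by rw [hz]; abel
    rw [this, norm_neg, norm_smul, Real.norm_eq_abs, abs_of_nonneg hs.1]
    calc s * ‖e‖ ≤ s₁ * ‖e‖ := by
          gcongr
          exact hs.2
      _ = _ := by rw [hs₁]; ring
  -- The quantity vanishes at `z`, and both `∇ρ` and `v` are Lipschitz, so at `y` it is at most a
  -- constant times `|y - z|`, itself at most a constant times `|ρ y|`.
  have hsplit : fderiv ℝ ρ y (v y) = (fderiv ℝ ρ y - fderiv ℝ ρ z) (v y)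
      + fderiv ℝ ρ z (v y - v z) := by
    rw [map_sub, htan]
    simp
  rw [hsplit, ← Real.norm_eq_abs]
  calc _ ≤ ‖(fderiv ℝ ρ y - fderiv ℝ ρ z) (v y)‖ + ‖fderiv ℝ ρ z (v y - v z)‖ := norm_add_le _ _
    _ ≤ (L * ‖y - z‖) * M + (‖fderiv ℝ ρ p‖ + 1) * (K * ‖y - z‖) := by
      refine add_le_add ?_ ?_
      · refine ((fderiv ℝ ρ y - fderiv ℝ ρ z).le_opNorm _).trans ?_
        refine mul_le_mul ?_ hvM (norm_nonneg _) (by positivity)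
        simpa [dist_eq_norm] using hL.dist_le_mul y (hball y hyball).2.1 z (hball z hzball).2.1
      · refine ((fderiv ℝ ρ z).le_opNorm _).trans ?_
        exact mul_le_mul (hball z hzball).1.2.le (hvK y (subset_closure hyΩ) z hzcl)
          (norm_nonneg _) (by positivity)
    _ = (L * M + (‖fderiv ℝ ρ p‖ + 1) * K) * ‖y - z‖ := by ring
    _ ≤ (L * M + (‖fderiv ℝ ρ p‖ + 1) * K) * (|ρ y| * (‖e‖ / c)) := by gcongr
    _ = _ := by ring

end Boundary

/-! ### Fluid trajectories stay in the domain -/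

section Trajectories

/-- Trajectories of a tangential field, followed backward in time, do not leave the domain. -/
theorem IsSmoothBoundedDomain.mem_of_backward {Ω : Set E3} (hΩ : IsSmoothBoundedDomain Ω) {T : ℝ}
    {f : ℝ → E3 → E3} {K : NNReal}
    (hf : LipschitzWith K fun p : ℝ × E3 => f p.1 p.2)
    (htan : ∀ t ∈ Ioc 0 T, ∀ q ∈ frontier Ω, ∀ n : E3, IsOutwardUnitNormal Ω q n →
      inner ℝ (f t q) n = 0)
    {γ : ℝ → E3} (hγ : ∀ t ∈ Icc 0 T, HasDerivWithinAt γ (f t (γ t)) (Icc 0 T) t)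
    (hγT : γ T ∈ Ω) : ∀ t ∈ Icc 0 T, γ t ∈ Ω := by
  by_contra! hcon
  have hγc : ContinuousOn γ (Icc 0 T) := fun t ht => (hγ t ht).continuousWithinAt
  set S : Set ℝ := Icc 0 T ∩ γ ⁻¹' Ωᶜ with hS
  have hSc : IsCompact S :=
    isCompact_Icc.of_isClosed_subset (hγc.preimage_isClosed_of_isClosed isClosed_Icc
      hΩ.isOpen.isClosed_compl) inter_subset_left
  -- The last time outside `Ω`: the trajectory is then on the boundary, and inside afterwards.
  obtain ⟨t₀, ⟨ht₀, ht₀Ω⟩, hmax⟩ := hSc.exists_isGreatest (by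
    obtain ⟨t, ht, htΩ⟩ := hcon
    exact ⟨t, ht, htΩ⟩)
  have hafter : ∀ t ∈ Ioc t₀ T, γ t ∈ Ω := by
    intro t ht
    by_contra h
    have := hmax ⟨⟨ht₀.1.trans ht.1.le, ht.2⟩, h⟩
    linarith [ht.1]
  have ht₀T : t₀ < T := lt_of_le_of_ne ht₀.2 fun h => ht₀Ω (h ▸ hγT)
  set p := γ t₀ with hp
  have hlim : Tendsto γ (𝓝[>] t₀) (𝓝 p) :=
    (hγc t₀ ht₀).mono_of_mem_nhdsWithin (mem_of_superset (Ioc_mem_nhdsGT ht₀T)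
      (fun t ht => ⟨ht₀.1.trans ht.1.le, ht.2⟩))
  have hpfr : p ∈ frontier Ω := by
    rw [hΩ.isOpen.frontier_eq]
    refine ⟨mem_closure_of_tendsto hlim ?_, ht₀Ω⟩
    filter_upwards [Ioc_mem_nhdsGT ht₀T] with t ht
    exact hafter t ht
  obtain ⟨ρ, hρ⟩ := hΩ.boundary p hpfr
  obtain ⟨C, hC⟩ := hρ.exists_tangential_bound hΩ.isOpen (K := K) (M := ‖f t₀ p‖ + 1)
    K.2 (by positivity)
  have hfγ : Tendsto (fun t => ‖f t (γ t)‖) (𝓝[>] t₀) (𝓝 ‖f t₀ p‖) := by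
    have h1 : ContinuousOn (fun t => ‖f t (γ t)‖) (Icc 0 T) :=
      (hf.continuous.comp_continuousOn (continuousOn_id.prodMk hγc)).norm
    exact (h1 t₀ ht₀).mono_of_mem_nhdsWithin (mem_of_superset (Ioc_mem_nhdsGT ht₀T)
      (fun t ht => ⟨ht₀.1.trans ht.1.le, ht.2⟩))
  have hev : ∀ᶠ t in 𝓝[>] t₀, |fderiv ℝ ρ (γ t) (f t (γ t))| ≤ C * |ρ (γ t)| ∧ ρ (γ t) < 0 := by
    filter_upwards [hlim.eventually hC, hlim.eventually hρ.mem_iff, Ioc_mem_nhdsGT ht₀T,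
      hfγ.eventually_lt_const (lt_add_one _)] with t h1 h2 ht h3
    refine ⟨h1 (hafter t ht) (f t) (fun x _ y _ => ?_) h3.le
      (htan t ⟨ht₀.1.trans_lt ht.1, ht.2⟩), h2.1 (hafter t ht)⟩
    have := hf.dist_le_mul (t, x) (t, y)
    simpa [Prod.dist_eq, dist_eq_norm] using this
  obtain ⟨t₁, ht₁, hIoc⟩ := (mem_nhdsGT_iff_exists_Ioc_subset).1
    (inter_mem hev (Ioc_mem_nhdsGT ht₀T))
  have ht₁' : t₀ < t₁ := ht₁
  have ht₁T : t₁ ≤ T := (hIoc ⟨ht₁', le_rfl⟩).2.2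
  have hd : Differentiable ℝ ρ := hρ.smooth.differentiable (by norm_num)
  -- The differential inequality holds only after `t₀`, so Grönwall starts at `a > t₀`. As `a` tends
  -- to `t₀`, `ρ(γ a)` tends to `0`, forcing `ρ(γ t₁) = 0` although `γ t₁` lies in `Ω`.
  have hbound : ∀ a ∈ Ioo t₀ t₁, ‖ρ (γ t₁)‖ ≤ ‖ρ (γ a)‖ * Real.exp (C * (t₁ - a)) := by
    intro a ha
    have hsub : Icc a t₁ ⊆ Icc 0 T := Icc_subset_Icc (ht₀.1.trans ha.1.le) ht₁T
    have := norm_le_gronwallBound_of_norm_deriv_right_le (f := fun t => ρ (γ t))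
      (f' := fun t => fderiv ℝ ρ (γ t) (f t (γ t))) (δ := ‖ρ (γ a)‖) (K := C) (ε := 0)
      (a := a) (b := t₁) (hd.continuous.comp_continuousOn (hγc.mono hsub)) (fun t ht => by
        have ht' : t ∈ Icc 0 T := hsub (Ico_subset_Icc_self ht)
        refine ((hd (γ t)).hasFDerivAt.comp_hasDerivWithinAt t (hγ t ht')).mono_of_mem_nhdsWithin ?_
        exact mem_of_superset (Icc_mem_nhdsGE (ht.2.trans_le ht₁T)) (Icc_subset_Icc_left ht'.1))
      le_rfl (fun t ht => by
        rw [add_zero]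
        exact (hIoc ⟨ha.1.trans_le ht.1, ht.2.le⟩).1.1) t₁ ⟨ha.2.le, le_rfl⟩
    rwa [gronwallBound_ε0] at this
  have hzero : ‖ρ (γ t₁)‖ ≤ 0 := by
    have h1 : Tendsto (fun a => ‖ρ (γ a)‖ * Real.exp (C * (t₁ - a))) (𝓝[>] t₀)
        (𝓝 (‖ρ p‖ * Real.exp (C * (t₁ - t₀)))) := by
      refine ((hd.continuous.norm.tendsto p).comp hlim).mul ?_
      have : Continuous fun a => Real.exp (C * (t₁ - a)) := by fun_prop
      exact this.continuousAt.mono_left nhdsWithin_le_nhds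
    rw [hρ.zero, norm_zero, zero_mul] at h1
    refine ge_of_tendsto h1 ?_
    filter_upwards [Ioo_mem_nhdsGT ht₁'] with a ha
    exact hbound a ha
  have hneg := (hIoc ⟨ht₁', le_rfl⟩).1.2
  rw [norm_le_zero_iff] at hzero
  linarith

/-- Through every point of the domain passes a trajectory, defined since the initial time. -/
theorem IsEulerSolution.exists_trajectory {D : FluidDomain} {s : ℝ} {Tstar : EReal}
    {u W : ℝ → E3 → E3} (hu : IsEulerSolution D s Tstar u)
    (hreg : IsRegularVelocity D.carrier (timeInterval Tstar) u W) {T : ℝ} (hT0 : 0 ≤ T)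
    (hI : Icc 0 T ⊆ timeInterval Tstar) {x : E3} (hx : x ∈ D.carrier) :
    ∃ γ : ℝ → E3, γ T = x ∧ (∀ t ∈ Icc 0 T, γ t ∈ D.carrier) ∧
      ∀ t ∈ Icc 0 T, HasDerivWithinAt γ (u t (γ t)) (Icc 0 T) t := by
  obtain ⟨K, hK⟩ := hreg.exists_lipschitz hI hu.continuousOn
  -- A Lipschitz extension to all of space and time gives a globally solvable equation; its values
  -- outside the closed domain become irrelevant once the trajectory is shown to stay inside.
  obtain ⟨g, hg, hug⟩ := hK.extend_finite_dimension
  set K' := lipschitzExtensionConstant E3 * K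
  have hug' : ∀ t ∈ Icc 0 T, ∀ y ∈ closure D.carrier, u t y = g (t, y) := fun t ht y hy =>
    hug (mk_mem_prod ht hy)
  obtain ⟨γ, hγT, hγ⟩ := exists_backward_solution (f := fun t y => g (t, y)) hT0 K'.2
    (fun t _ y z => by
      have := hg.dist_le_mul (t, y) (t, z)
      simpa [Prod.dist_eq, dist_eq_norm] using this)
    (fun y => (hg.continuous.comp (by fun_prop : Continuous fun t : ℝ => (t, y))).continuousOn) x
  have hmem : ∀ t ∈ Icc 0 T, γ t ∈ D.carrier := by
    cases D with
    | space => exact fun _ _ => trivial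
    | torus => exact fun _ _ => trivial
    | bounded Ω hΩ =>
      refine hΩ.mem_of_backward (f := fun t y => g (t, y)) hg (fun t ht q hq n hn => ?_) hγ
        (hγT ▸ hx)
      have ht' : t ∈ Icc 0 T := Ioc_subset_Icc_self ht
      change inner ℝ (g (t, q)) n = 0
      rw [← hug' t ht' q (frontier_subset_closure hq)]
      exact hu.impermeable t (hI ht') ht.1 q hq n hn
  refine ⟨γ, hγT, hmem, fun t ht => ?_⟩
  rw [hug' t ht _ (subset_closure (hmem t ht))]
  exact hγ t ht

end Trajectories

end EulerFlow

namespace EulerFlow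

/-! ### The vorticity equation and the final estimate -/

section Vorticity

/-- The axial vector as a continuous linear map. -/
noncomputable def axialCLM : (E3 →L[ℝ] E3) →L[ℝ] E3 where
  toFun := axial
  map_add' A B := by
    ext i
    fin_cases i <;> simp [axial, entry] <;> ring
  map_smul' c A := by
    ext i
    fin_cases i <;> simp [axial, entry] <;> ring
  cont := continuous_axial

/-- The algebraic form of the vorticity equation: only the quadratic term of the material derivative
`-A² - H` contributes to the axial vector. -/
theorem axial_eq_of_symmetric {A B H : E3 →L[ℝ] E3} (hB : ∀ v, B v = -H v - A (A v))
    (hH : ∀ v w, inner ℝ (H v) w = inner ℝ (H w) v) (htr : tr A = 0) :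
    axial B = A (axial A) := by
  have hentry : ∀ i j, entry B i j = -entry H i j
      - (entry A i 0 * entry A 0 j + entry A i 1 * entry A 1 j + entry A i 2 * entry A 2 j) := by
    intro i j
    have h1 := apply_coord A (A (EuclideanSpace.single j 1)) i
    simp only [entry] at h1 ⊢
    rw [hB, PiLp.sub_apply, PiLp.neg_apply, h1]
  have hsymm : ∀ i j, entry H i j = entry H j i := by
    intro i j
    have := hH (EuclideanSpace.single j 1) (EuclideanSpace.single i 1)
    rw [EuclideanSpace.inner_single_right, EuclideanSpace.inner_single_right] at this
    simpa [entry] using this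
  unfold tr at htr
  have h0 : axial A 0 = entry A 2 1 - entry A 1 2 := rfl
  have h1 : axial A 1 = entry A 0 2 - entry A 2 0 := rfl
  have h2 : axial A 2 = entry A 1 0 - entry A 0 1 := rfl
  -- The symmetric `H` contributes nothing, and the axial vector of `-A²` is `Aω - (tr A) ω` with `ω
  -- = axial A`.
  ext i
  rw [apply_coord, h0, h1, h2]
  fin_cases i
  · change entry B 2 1 - entry B 1 2 = _
    rw [hentry, hentry, hsymm 2 1]
    simp only [Fin.zero_eta, Fin.isValue]
    linear_combination (-(entry A 2 1 - entry A 1 2)) * htr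
  · change entry B 0 2 - entry B 2 0 = _
    rw [hentry, hentry, hsymm 0 2]
    simp only [Fin.mk_one, Fin.isValue]
    linear_combination (-(entry A 0 2 - entry A 2 0)) * htr
  · change entry B 1 0 - entry B 0 1 = _
    rw [hentry, hentry, hsymm 1 0]
    simp only [Fin.reduceFinMk, Fin.isValue]
    linear_combination (-(entry A 1 0 - entry A 0 1)) * htr

/-- The derivative of a differentiable gradient field is symmetric. -/
theorem inner_fderiv_gradient_symm {Ω : Set E3} (hΩ : IsOpen Ω) {P : E3 → ℝ} {q : E3 → E3}
    (hP : ∀ x ∈ Ω, DifferentiableAt ℝ P x ∧ gradient P x = q x) {x : E3} (hx : x ∈ Ω)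
    {q' : E3 →L[ℝ] E3} (hq : HasFDerivAt q q' x) (v w : E3) :
    inner ℝ (q' v) w = inner ℝ (q' w) v := by
  have h1 : ∀ᶠ y in 𝓝 x, HasFDerivAt P (innerSL ℝ (q y)) y := by
    filter_upwards [hΩ.mem_nhds hx] with y hy
    have h2 : innerSL ℝ (q y) = fderiv ℝ P y := by
      ext v
      rw [innerSL_apply_apply, ← (hP y hy).2, inner_gradient_eq_fderiv]
    rw [h2]
    exact (hP y hy).1.hasFDerivAt
  have h2 : HasFDerivAt (fun y => innerSL ℝ (q y)) ((innerSL ℝ).comp q') x :=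
    (innerSL ℝ (E := E3)).hasFDerivAt.comp x hq
  have := second_derivative_symmetric_of_eventually h1 h2 v w
  simpa using this

theorem timeInterval_mem_nhds {Tstar : EReal} {t : ℝ} (ht : t ∈ timeInterval Tstar) (h0 : 0 < t) :
    timeInterval Tstar ∈ 𝓝 t := by
  have h1 : ∀ᶠ τ : ℝ in 𝓝 t, (τ : EReal) < Tstar :=
    continuous_coe_real_ereal.continuousAt.eventually_lt_const ht.2
  filter_upwards [h1, lt_mem_nhds h0] with τ h2 h3
  exact ⟨h3.le, h2⟩

/-- The vorticity equation along trajectories. -/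
theorem IsEulerSolution.hasDerivWithinAt_axial {D : FluidDomain} {s : ℝ} {Tstar : EReal}
    {u W : ℝ → E3 → E3} (hu : IsEulerSolution D s Tstar u)
    (hreg : IsRegularVelocity D.carrier (timeInterval Tstar) u W) {J : Set ℝ}
    (hJ : J ⊆ timeInterval Tstar) {γ : ℝ → E3} (hmem : ∀ t ∈ J, γ t ∈ D.carrier) {t : ℝ}
    (ht : t ∈ J) (ht0 : 0 < t) (hγ : HasDerivWithinAt γ (u t (γ t)) J t) :
    HasDerivWithinAt (fun τ => axial (fderiv ℝ (u τ) (γ τ)))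
      (fderiv ℝ (u t) (γ t) (axial (fderiv ℝ (u t) (γ t)))) J t := by
  have hΩ := D.isOpen_carrier
  have hB := hreg.hasDerivWithinAt_fderiv hΩ hJ hmem ht hγ
  refine (axialCLM.hasFDerivAt.comp_hasDerivWithinAt t hB).congr_deriv ?_
  obtain ⟨P, hP⟩ := hu.momentum
  obtain ⟨-, hP⟩ := hP t (hJ ht) ht0
  -- This is the pressure gradient, differentiable because `u` and `W` are `C²`. Differentiating its
  -- formula shows that the material derivative of `A` is `-A² - H`, with `H` the symmetric Hessian
  -- of the pressure.
  set q : E3 → E3 := fun x => -(fderiv ℝ (u t) x (u t x)) - W t x with hq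
  have hgrad : ∀ x ∈ D.carrier, DifferentiableAt ℝ (P t) x ∧ gradient (P t) x = q x := by
    intro x hx
    obtain ⟨h1, h2⟩ := hP x hx
    refine ⟨h1, ?_⟩
    have h3 := (hreg.hasDerivWithinAt (hJ ht) hx).hasDerivAt (timeInterval_mem_nhds (hJ ht) ht0)
    change gradient (P t) x = -(fderiv ℝ (u t) x (u t x)) - W t x
    rw [h3.unique h2]
    abel
  have hx := hmem t ht
  have hcd := hreg.contDiffAt hΩ (hJ ht) hx
  have hud := hcd.differentiableAt (by norm_num)
  have hdd : DifferentiableAt ℝ (fderiv ℝ (u t)) (γ t) :=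
    (hcd.fderiv_right (m := 1) (by norm_num)).differentiableAt (by norm_num)
  have hWd := (hreg.contDiffAt_deriv hΩ (hJ ht) hx).differentiableAt (by norm_num)
  have hq' := (hdd.hasFDerivAt.clm_apply hud.hasFDerivAt).neg.sub hWd.hasFDerivAt
  have hsymm : ∀ v w, fderiv ℝ (fderiv ℝ (u t)) (γ t) v w = fderiv ℝ (fderiv ℝ (u t)) (γ t) w v :=
    fun v w => (hcd.isSymmSndFDerivAt (by simp)) v w
  refine axial_eq_of_symmetric (fun v => ?_)
    (fun v w => inner_fderiv_gradient_symm hΩ hgrad hx hq' v w) ?_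
  · simp only [add_apply, sub_apply, neg_apply, ContinuousLinearMap.comp_apply,
      ContinuousLinearMap.flip_apply, hsymm _ v]
    abel
  · rw [← divergence_eq_tr]
    exact hu.incompressible t (hJ ht) ht0 _ hx

/-- The set where `|f|` exceeds its essential supremum is open by continuity and null, hence empty.
-/
theorem enorm_le_eLpNorm_top {Ω : Set E3} (hΩ : IsOpen Ω) {f : E3 → E3} (hf : ContinuousOn f Ω)
    {x : E3} (hx : x ∈ Ω) : ‖f x‖ₑ ≤ eLpNorm f ∞ ((volume : Measure E3).restrict Ω) := by
  by_contra! hlt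
  set N := eLpNorm f ∞ ((volume : Measure E3).restrict Ω) with hN
  have hV : IsOpen (Ω ∩ (fun y => ‖f y‖ₑ) ⁻¹' Ioi N) := hf.enorm.isOpen_inter_preimage hΩ isOpen_Ioi
  have hpos := hV.measure_pos volume ⟨x, hx, hlt⟩
  have hae : ∀ᵐ y ∂(volume : Measure E3).restrict Ω, ‖f y‖ₑ ≤ N := by
    rw [hN, eLpNorm_exponent_top]
    exact enorm_ae_le_eLpNormEssSup f _
  rw [ae_restrict_iff' hΩ.measurableSet, ae_iff] at hae
  refine hpos.ne' (measure_mono_null (fun y hy => ?_) hae)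
  simp only [mem_ofPred_eq, Classical.not_imp, not_le]
  exact hy

end Vorticity

/-- The amplitude growth rate dominates the growth of the vorticity. -/
theorem iSup_curl_div_le_beta (D : FluidDomain) (s : ℝ) (hs : 9 / 2 < s) (Tstar : EReal)
    (u : ℝ → E3 → E3) (hu : IsEulerSolution D s Tstar u)
    (T : ℝ) (hT0 : 0 ≤ T) (hT : (T : EReal) < Tstar) :
    (⨆ x ∈ D.carrier, ‖curl (u T) x‖ₑ ^ (1 / 2 : ℝ)) /
        (eLpNorm (curl (u 0)) ∞ (volume.restrict D.carrier)) ^ (1 / 2 : ℝ) ≤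
      beta D u T := by
  obtain ⟨W, hreg⟩ := hu.exists_isRegularVelocity hs
  have hI : Icc 0 T ⊆ timeInterval Tstar := fun t ht =>
    ⟨ht.1, (EReal.coe_le_coe_iff.2 ht.2).trans_lt hT⟩
  have hΩ := D.isOpen_carrier
  have h0 : (0 : ℝ) ∈ Icc 0 T := ⟨le_rfl, hT0⟩
  -- The multiplied form also settles the conventions for the quotient: when the initial vorticity
  -- vanishes, it forces the numerator to be `0`.
  refine ENNReal.div_le_of_le_mul (iSup₂_le fun x hx => ?_)
  by_cases hne : curl (u T) x = 0
  · simp [hne]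
  obtain ⟨γ, hγT, hmem, hγ⟩ := hu.exists_trajectory hreg hT0 hI hx
  obtain ⟨ξ, b, hξ, hb, hξ0, hb0, hbξ, hle⟩ := exists_amplitude
    (A := fun t => fderiv ℝ (u t) (γ t)) hT0
    (hreg.continuousOn_fderiv hΩ hI (fun t ht => (hγ t ht).continuousWithinAt) hmem)
    (fun t ht => by
      rw [← divergence_eq_tr]
      have ht' := Ioo_subset_Icc_self ht
      exact hu.incompressible t (hI ht') ht.1 _ (hmem t ht'))
    (fun t ht => hu.hasDerivWithinAt_axial hreg hI hmem (Ioo_subset_Icc_self ht) ht.1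
      (hγ t (Ioo_subset_Icc_self ht)))
    (by rw [hγT]; exact hne)
  have hβ : ‖b T‖ₑ ≤ beta D u T := by
    unfold beta
    exact le_iSup_of_le γ <| le_iSup_of_le ξ <| le_iSup_of_le b <|
      le_iSup_of_le ⟨hmem, hγ, hξ, hb⟩ <| le_iSup_of_le hb0 <| le_iSup_of_le hξ0 <|
      le_iSup_of_le hbξ le_rfl
  have hcurl : ContinuousOn (curl (u 0)) D.carrier := fun y hy =>
    (continuous_axial.continuousAt.comp
      ((hreg.contDiffAt hΩ (hI h0) hy).continuousAt_fderiv (by norm_num))).continuousWithinAt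
  have hN := enorm_le_eLpNorm_top hΩ hcurl (hmem 0 h0)
  rw [hγT, ← curl_eq_axial, ← curl_eq_axial] at hle
  have hle' : ‖curl (u T) x‖ₑ ≤ ‖curl (u 0) (γ 0)‖ₑ * ‖b T‖ₑ ^ 2 := by
    rw [← ofReal_norm, ← ofReal_norm, ← ofReal_norm, ← ENNReal.ofReal_pow (norm_nonneg _),
      ← ENNReal.ofReal_mul (norm_nonneg _)]
    exact ENNReal.ofReal_le_ofReal hle
  calc ‖curl (u T) x‖ₑ ^ (1 / 2 : ℝ)
      ≤ (eLpNorm (curl (u 0)) ∞ (volume.restrict D.carrier) * beta D u T ^ 2) ^ (1 / 2 : ℝ) := by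
        refine ENNReal.rpow_le_rpow (hle'.trans ?_) (by norm_num)
        gcongr
    _ = beta D u T * (eLpNorm (curl (u 0)) ∞ (volume.restrict D.carrier)) ^ (1 / 2 : ℝ) := by
        rw [ENNReal.mul_rpow_of_nonneg _ _ (by norm_num), ← ENNReal.rpow_natCast,
          ← ENNReal.rpow_mul, mul_comm]
        norm_num

end EulerFlow

theorem proposition1 (D : EulerFlow.FluidDomain) (s : ℝ) (hs : 9 / 2 < s) (Tstar : EReal)
    (u : ℝ → EulerFlow.E3 → EulerFlow.E3) (hu : EulerFlow.IsEulerSolution D s Tstar u)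
    (T : ℝ) (hT0 : 0 ≤ T) (hT : (T : EReal) < Tstar) :
    (⨆ x ∈ D.carrier, ‖EulerFlow.curl (u T) x‖ₑ ^ (1 / 2 : ℝ)) /
        (eLpNorm (EulerFlow.curl (u 0)) ∞ (volume.restrict D.carrier)) ^ (1 / 2 : ℝ) ≤
      EulerFlow.beta D u T :=
  EulerFlow.iSup_curl_div_le_beta D s hs Tstar u hu T hT0 hT
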